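/- **Proposition (commuting diagram for a single incoming edge).** *Terms.* Terms of the $\lambda$-calculus with `letrec` are given by $t ::= v \mid \lambda v.\,t \mid t\,t \mid \mathtt{letrec}\ f_1=t_1\dots f_n=t_n\ \mathtt{in}\ t$. Let $t$ be such a term in which distinct binders bind distinct variables and no variable occurs both free and bound. *Unfolding.* Write $t \twoheadrightarrow_{\triangledown}^{\infty} T$ if $T$ is the infinite unfolding of $t$: the `letrec`-free, finite or infinite $\lambda$-term obtained as the limit of a strongly convergent outermost reduction with the rule $\mathtt{letrec}\ D\ \mathtt{in}\ b(f_1,\dots,f_n)\to b(\mathtt{letrec}\ D\ \mathtt{in}\ s_1,\dots,\mathtt{letrec}\ D\ \mathtt{in}\ s_n)$, where $D=\{f_i=s_i\}_{i\le n}$, performed without renaming of variables. The result is read as a $\lambda$-term up to $\alpha$-equivalence in which every abstraction remembers the name it has in $t$. *Binding graph.* Types are simple types whose arrows are annotated with a variable $x$ or with $\varepsilon$; $\tau^{\varepsilon}$ denotes $\tau$ with its outermost annotation replaced by $\varepsilon$. Edges $x\rightsquigarrow d$ go from a variable to a term or to the black hole $\bullet$. Put $\mathrm{bh}((\mathsf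 T\to\mathsf S)^x)=\mathrm{bh}(\mathsf S)\cup\{x\rightsquigarrow\bullet\}$, $\mathrm{bh}((\mathsf T\to\mathsf S)^\varepsilon)=\mathrm{bh}(\mathsf S)$ and $\mathrm{bh}=\emptyset$ at base types. Judgements $B\mid\Gamma\Rightarrow t:\mathsf S$ are derived by the rules: - variables: $\emptyset\mid\Gamma\Rightarrow v:\Gamma(v)$; - abstraction: if $B\mid\Gamma,x:\tau^\varepsilon\Rightarrow b:\mathsf S$, then $B\mid\Gamma\Rightarrow\lambda x.b:(\tau^\varepsilon\to\mathsf S)^x$; - application: if $B_1\mid\Gamma\Rightarrow p:(\mathsf T\to\mathsf S)^a$ and $B_2\mid\Gamma\Rightarrow q:\mathsf R$, where $\mathsf T,\mathsf R$ agree up to annotations, then $B_1\cup B_2\cup E\cup\mathrm{bh}(\mathsf R)\mid\Gamma\Rightarrow p\,q:\mathsf S$, with $E=\{a\rightsquigarrow q\}$ if $a$ is a variable and $E=\emptyset$ if $a=\varepsilon$; - letrec: if $B_i\mid\Gamma,f_1:\mathsf T_1,\dots,f_n:\mathsf T_n\Rightarrow t_i:\mathsf T_i$ for $0\le i\le n$,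 then $\bigcup_i B_i\mid\Gamma\Rightarrow\mathtt{letrec}\ f_1=t_1\dots f_n=t_n\ \mathtt{in}\ t_0:\mathsf T_0$. If $B\mid\Gamma\Rightarrow t:\mathsf S$, then $B\cup\mathrm{bh}(\mathsf S)$ is a binding graph of $t$. *The two transformations.* A generalised $\beta$-redex ($g\beta$-redex) involving $\lambda x$ is an application whose argument is matched, along a balanced segment of the spine (applications and abstractions in between cancel out), with an abstraction $\lambda x$; contracting it removes the application and this $\lambda x$ and substitutes the argument for the variable, avoiding capture. Write $T \xrightarrow{\mathit{red}} T'$ if $T'$ is the limit of contracting all $g\beta$-redexes of $T$ that involve an abstraction named $x$ (outermost ones first, finitely many at each position). For a term $e$ let $\mathit{trans}(t)$ be obtained from $t$ by replacing (without renaming) all occurrences of $x$ by $e$ and removing $\lambda x$ together with the application nodes, and their arguments, that are matched with it along the spine, where the spine is continued from a variable $f$ bound by an equation $f=s$ into $s$. *Claim.* Let $T$ be the infinite unfolding of $t$, let $x$ be a variable abstracted in $t$, and suppose that in a binding graph of $t$ (for some $\Gamma$) the only edge from $x$ to a term or to the black hole is $x\rightsquigarrow e$. Then the diagram $$\begin{array}{rcl}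 t & \twoheadrightarrow_{\triangledown}^{\infty} & T\\ {\scriptstyle\mathit{trans}}\downarrow & & \downarrow{\scriptstyle\mathit{red}}\\ t' & \twoheadrightarrow_{\triangledown}^{\infty} & T'\end{array}$$ commutes: there is a $T'$ with $T\xrightarrow{\mathit{red}}T'$ if and only if $t'=\mathit{trans}(t)$ has an infinite unfolding, and in that case both routes yield the same term: if $T\xrightarrow{\mathit{red}}T_1$ and $t'\twoheadrightarrow_{\triangledown}^{\infty}T_2$, then $T_1=T_2$. -/

import Mathlib

universe u

namespace LetrecCalc

/-! ### Finite terms with `letrec` -/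

/-- First-order terms of the lambda calculus with `letrec`, over a set `V` of variables.
`letrec n f s b` is `letrec f 0 = s 0, ..., f (n-1) = s (n-1) in b`. -/
inductive Term (V : Type u) : Type u
  | var (v : V) : Term V
  | lam (v : V) (b : Term V) : Term V
  | app (p q : Term V) : Term V
  | letrec (n : ℕ) (f : Fin n → V) (s : Fin n → Term V) (b : Term V) : Term V

namespace Term

variable {V : Type u}

/-- All binding occurrences of variables (of abstractions and of equations), as a list. -/
def binders : Term V → List V
  | var _ => []
  | lam v b => v :: binders b
  | app p q => binders p ++ binders q
  | letrec _ f s b => List.ofFn f ++ ((List.ofFn fun i => binders (s i)).flatten ++ binders b)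

/-- The variables that have a free occurrence. -/
def free : Term V → Set V
  | var v => {v}
  | lam v b => free b \ {v}
  | app p q => free p ∪ free q
  | letrec _ f s b => ((⋃ i, free (s i)) ∪ free b) \ Set.range f

/-- Globally unique variable naming: distinct binders bind distinct variables, and no variable
has both a free and a bound occurrence. -/
def WellNamed (t : Term V) : Prop :=
  t.binders.Nodup ∧ ∀ v ∈ t.free, v ∉ t.binders

/-- `Sub s t`: `s` is a subterm of `t`. -/
inductive Sub : Term V → Term V → Prop
  | refl (t : Term V) : Sub t t
  | lam {s b : Term V} (v : V) : Sub s b → Sub s (lam v b)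
  | appL {s p : Term V} (q : Term V) : Sub s p → Sub s (app p q)
  | appR {s q : Term V} (p : Term V) : Sub s q → Sub s (app p q)
  | letrecDef {r : Term V} {n : ℕ} (f : Fin n → V) {s : Fin n → Term V} (b : Term V) (i : Fin n) :
      Sub r (s i) → Sub r (letrec n f s b)
  | letrecBody {r : Term V} {n : ℕ} (f : Fin n → V) (s : Fin n → Term V) {b : Term V} :
      Sub r b → Sub r (letrec n f s b)

/-- There is an abstraction over `x` in `t`. -/
def Abstracts (t : Term V) (x : V) : Prop := ∃ b, Sub (lam x b) t

/-- `t` contains the equation `f = d` in one of its `letrec`s. -/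
def HasEquation (t : Term V) (f : V) (d : Term V) : Prop :=
  ∃ (n : ℕ) (g : Fin n → V) (s : Fin n → Term V) (b : Term V) (i : Fin n),
    Sub (letrec n g s b) t ∧ g i = f ∧ s i = d

open Classical in
/-- Simultaneous substitution for free occurrences, without any renaming of binders. -/
noncomputable def subst (θ : V → Term V) : Term V → Term V
  | var v => θ v
  | lam v b => lam v (subst (Function.update θ v (var v)) b)
  | app p q => app (subst θ p) (subst θ q)
  | letrec n f s b =>
      letrec n f (fun i => subst (Function.extend f (fun j => var (f j)) θ) (s i))
        (subst (Function.extend f (fun j => var (f j)) θ) b)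

/-- The `letrec`-unfolding rule
`letrec Defs in b(f₁,...,fₙ) → b(letrec Defs in s₁, ..., letrec Defs in sₙ)`, at the root.
If no `fᵢ` is free in `b`, then the result is `b`, so that the rule which drops a superfluous
`letrec` is an instance. -/
inductive UnfoldStep : Term V → Term V → Prop
  | mk (n : ℕ) (f : Fin n → V) (s : Fin n → Term V) (b : Term V) :
      UnfoldStep (letrec n f s b)
        (subst (Function.extend f (fun i => letrec n f s (s i)) var) b)

end Term

/-! ### Infinite lambda terms -/

/-- Node labels of infinite lambda terms. Bound variables are de Bruijn indices, and an abstraction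
carries the name of its variable as a mark, so that one can speak of the abstractions `λx`. -/
inductive Node (V : Type u) : Type u
  | bvar (n : ℕ) : Node V
  | fvar (v : V) : Node V
  | lam (v : V) : Node V
  | app : Node V

/-- The index type of the children of a node. -/
def Node.Child {V : Type u} : Node V → Type
  | bvar _ => Empty
  | fvar _ => Empty
  | lam _ => Unit
  | app => Bool

/-- The signature of lambda terms. -/
def sig (V : Type u) : PFunctor.{u, 0} := ⟨Node V, Node.Child⟩

/-- Finite or infinite lambda terms (without `letrec`): the final coalgebra of the signature. -/
abbrev ITerm (V : Type u) : Type u := (sig V).M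

namespace ITerm

variable {V : Type u}

/-- A variable bound by the `n`-th enclosing abstraction. -/
def bvar (n : ℕ) : ITerm V := PFunctor.M.mk ⟨Node.bvar n, fun c => Empty.elim c⟩

/-- A free variable. -/
def fvar (v : V) : ITerm V := PFunctor.M.mk ⟨Node.fvar v, fun c => Empty.elim c⟩

/-- An abstraction, marked with the name `v`. -/
def lam (v : V) (b : ITerm V) : ITerm V := PFunctor.M.mk ⟨Node.lam v, fun _ => b⟩

/-- An application; the child `false` is the function and `true` is the argument. -/
def app (p q : ITerm V) : ITerm V :=
  PFunctor.M.mk ⟨Node.app, fun c : Bool => if c then q else p⟩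

/-- A renaming of indices below an abstraction. -/
def liftRen (ξ : ℕ → ℕ) : ℕ → ℕ
  | 0 => 0
  | n + 1 => ξ n + 1

/-- One step of `rename`. -/
def renameStep (st : ITerm V × (ℕ → ℕ)) : (sig V) (ITerm V × (ℕ → ℕ)) :=
  match PFunctor.M.dest st.1 with
  | ⟨Node.bvar n, _⟩ => ⟨Node.bvar (st.2 n), fun c => Empty.elim c⟩
  | ⟨Node.fvar v, _⟩ => ⟨Node.fvar v, fun c => Empty.elim c⟩
  | ⟨Node.lam v, ch⟩ => ⟨Node.lam v, fun c => (ch c, liftRen st.2)⟩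
  | ⟨Node.app, ch⟩ => ⟨Node.app, fun c => (ch c, st.2)⟩

/-- Renaming of the free indices of an infinite term. -/
def rename (ξ : ℕ → ℕ) (T : ITerm V) : ITerm V := PFunctor.M.corec renameStep (T, ξ)

/-- Move a term below one more abstraction. -/
def shift (T : ITerm V) : ITerm V := rename Nat.succ T

/-- A substitution for indices below an abstraction. -/
def liftSub (θ : ℕ → ITerm V) : ℕ → ITerm V
  | 0 => bvar 0
  | n + 1 => shift (θ n)

/-- One step of `subst`: at a variable the substituted term takes over, and below its root
nothing is substituted any more. -/
def substStep (st : ITerm V × (ℕ → ITerm V)) : (sig V) (ITerm V × (ℕ → ITerm V)) :=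
  match PFunctor.M.dest st.1 with
  | ⟨Node.bvar n, _⟩ =>
      ⟨(PFunctor.M.dest (st.2 n)).1, fun c => ((PFunctor.M.dest (st.2 n)).2 c, bvar)⟩
  | ⟨Node.fvar v, _⟩ => ⟨Node.fvar v, fun c => Empty.elim c⟩
  | ⟨Node.lam v, ch⟩ => ⟨Node.lam v, fun c => (ch c, liftSub st.2)⟩
  | ⟨Node.app, ch⟩ => ⟨Node.app, fun c => (ch c, st.2)⟩

/-- Capture-avoiding substitution for all free indices of an infinite term. -/
def subst (θ : ℕ → ITerm V) (T : ITerm V) : ITerm V := PFunctor.M.corec substStep (T, θ)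

/-- `inst M E` is `M[0 := E]`: the contractum of the redex `(λ M) E`. -/
def inst (M E : ITerm V) : ITerm V :=
  subst (fun n => match n with
    | 0 => E
    | n + 1 => bvar n) M

/-- `Contract x k E P R`: going down the spine of `P`, the first abstraction that is left over
after the abstractions and applications on the way have cancelled out, with `k` further
abstractions to be skipped, is a `λx`; and `R` is `P` with that `λx` removed and `E` substituted for
its variable. -/
inductive Contract (x : V) : ℕ → ITerm V → ITerm V → ITerm V → Prop
  | hit (E M : ITerm V) : Contract x 0 E (lam x M) (inst M E)
  | skip {k : ℕ} {E M R : ITerm V} (y : V) :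
      Contract x k (shift E) M R → Contract x (k + 1) E (lam y M) (lam y R)
  | app {k : ℕ} {E P R : ITerm V} (Q : ITerm V) :
      Contract x (k + 1) E P R → Contract x k E (app P Q) (app R Q)

/-- Contraction, at the root, of a generalised beta redex whose abstraction is a `λx`: the
argument `E` is matched with a `λx` from which it is separated by a balanced spine
segment. For the empty segment this is a beta step `(λx. M) E → M[x := E]`; the next case is
`(λy. λx. M) N E → (λy. M[x := E]) N`. -/
inductive GBetaStep (x : V) : ITerm V → ITerm V → Prop
  | mk {P E R : ITerm V} : Contract x 0 E P R → GBetaStep x (app P E) R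

/-- `ContractAll x T T'`: the term `T'` results from `T` by contracting all generalised beta redexes
that involve a `λx`. This is the coinductive form of a strongly convergent outermost
reduction: finitely many contractions at the root lead to a term whose root is not such a redex;
this root is kept, and the same is done in the immediate subterms. -/
def ContractAll (x : V) (T T' : ITerm V) : Prop :=
  ∃ R : ITerm V → ITerm V → Prop, R T T' ∧
    ∀ S S', R S S' → ∃ U, Relation.ReflTransGen (GBetaStep x) S U ∧ (∀ W, ¬ GBetaStep x U W) ∧
      ∃ (a : Node V) (ch ch' : a.Child → ITerm V),
        PFunctor.M.dest U = ⟨a, ch⟩ ∧ PFunctor.M.dest S' = ⟨a, ch'⟩ ∧ ∀ c, R (ch c) (ch' c)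

end ITerm

/-! ### Infinite unfolding -/

open Classical in
/-- The occurrence of the variable `v` below abstractions over the variables in `ctx`, innermost
first. -/
noncomputable def resolve {V : Type u} (ctx : List V) (v : V) : ITerm V :=
  if v ∈ ctx then ITerm.bvar (ctx.idxOf v) else ITerm.fvar v

/-- What a term `u` (below abstractions over `ctx`) whose root is not a `letrec`
contributes to its infinite unfolding `T`, if the immediate subterms unfold as `R` says. -/
def UnfoldRoot {V : Type u} (R : Term V → List V → ITerm V → Prop) :
    Term V → List V → ITerm V → Prop
  | Term.var v, ctx, T => T = resolve ctx v
  | Term.lam v b, ctx, T => ∃ M, T = ITerm.lam v M ∧ R b (v :: ctx) M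
  | Term.app p q, ctx, T => ∃ P Q, T = ITerm.app P Q ∧ R p ctx P ∧ R q ctx Q
  | Term.letrec _ _ _ _, _, _ => False

/-- `Unfolds t T`: `T` is the infinite unfolding of `t`, i.e. the limit of a strongly convergent
outermost `letrec`-unfolding (without renaming) of `t` to a term without `letrec`, read as a lambda
term. In coinductive form: finitely many unfolding steps at the root lead to a term whose root is
not a `letrec`, and the immediate subterms are treated likewise. -/
def Unfolds {V : Type u} (t : Term V) (T : ITerm V) : Prop :=
  ∃ R : Term V → List V → ITerm V → Prop, R t [] T ∧
    ∀ s ctx S, R s ctx S →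
      ∃ w, Relation.ReflTransGen Term.UnfoldStep s w ∧ UnfoldRoot R w ctx S

/-! ### Annotated types and the binding graph -/

/-- Simple types. -/
inductive SType : Type
  | base (n : ℕ) : SType
  | arr (a b : SType) : SType

/-- Annotated types: every arrow carries the name of the variable bound by the corresponding
abstraction, or `none` (written ε) if that variable is not determined. -/
inductive AType (V : Type u) : Type u
  | base (n : ℕ) : AType V
  | arr (ann : Option V) (a b : AType V) : AType V

namespace AType

variable {V : Type u}

/-- Remove all annotations. -/
def bare : AType V → SType
  | base n => SType.base n
  | arr _ a b => SType.arr (bare a) (bare b)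

/-- `τ ↦ τ^ε`: replace the outermost annotation by ε. -/
def eps : AType V → AType V
  | base n => base n
  | arr _ a b => arr none a b

end AType

/-- Sets of edges `x ⇝ d` of binding graphs, as pairs `(x, d)`; `none` is the black hole. -/
abbrev Edges (V : Type u) : Type u := Set (V × Option (Term V))

/-- `bind(x, e)`. -/
def bindEdge {V : Type u} : Option V → Term V → Edges V
  | none, _ => ∅
  | some x, e => {(x, some e)}

/-- `blackholes(T)`. -/
def blackholes {V : Type u} : AType V → Edges V
  | AType.base _ => ∅
  | AType.arr none _ b => blackholes b
  | AType.arr (some x) _ b => blackholes b ∪ {(x, none)}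

open Classical in
/-- `Infer B Γ e S`: the judgement `B | Γ ⇒ e : S` of the annotated type system. -/
inductive Infer {V : Type u} : Edges V → (V → Option (AType V)) → Term V → AType V → Prop
  | var {Γ : V → Option (AType V)} {v : V} {S : AType V} :
      Γ v = some S → Infer ∅ Γ (Term.var v) S
  | abs {B : Edges V} {Γ : V → Option (AType V)} {x : V} {a S : AType V} {e : Term V} :
      Infer B (Function.update Γ x (some a.eps)) e S →
      Infer B Γ (Term.lam x e) (AType.arr (some x) a.eps S)
  | app {B₁ B₂ : Edges V} {Γ : V → Option (AType V)} {ann : Option V} {T S R : AType V}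
      {e₁ e₂ : Term V} :
      Infer B₁ Γ e₁ (AType.arr ann T S) → Infer B₂ Γ e₂ R → T.bare = R.bare →
      Infer (B₁ ∪ B₂ ∪ bindEdge ann e₂ ∪ blackholes R) Γ (Term.app e₁ e₂) S
  | letrec {n : ℕ} {f : Fin n → V} {s : Fin n → Term V} {b : Term V}
      {Γ : V → Option (AType V)} {B₀ : Edges V} {B : Fin n → Edges V}
      {S : AType V} {T : Fin n → AType V} :
      (∀ i, Infer (B i) (Function.extend f (fun j => some (T j)) Γ) (s i) (T i)) →
      Infer B₀ (Function.extend f (fun j => some (T j)) Γ) b S →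
      Infer (B₀ ∪ ⋃ i, B i) Γ (Term.letrec n f s b) S

/-- `G` is a binding graph of `t` (in a context `Γ` for its free variables): the edges that are
inferred for `t`, and a black hole for every variable that is exposed by `t` as a whole, since
there the end of the spine is reached and nothing is known about future arguments. -/
def IsBindingGraph {V : Type u} (Γ : V → Option (AType V)) (t : Term V) (G : Edges V) : Prop :=
  ∃ B S, Infer B Γ t S ∧ G = B ∪ blackholes S

/-! ### The transformation -/

/-- `Exposes t x k p`, for a subterm `p` of the uniquely named term `t`: when `p` is given `k`
arguments, the next argument is matched, along the spine and through the equations of `t`, with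
the abstraction `λx`. -/
inductive Exposes {V : Type u} (t : Term V) (x : V) : ℕ → Term V → Prop
  | hit (b : Term V) : Exposes t x 0 (Term.lam x b)
  | lam {k : ℕ} {b : Term V} (y : V) : Exposes t x k b → Exposes t x (k + 1) (Term.lam y b)
  | app {k : ℕ} {p : Term V} (q : Term V) :
      Exposes t x (k + 1) p → Exposes t x k (Term.app p q)
  | letrec {k n : ℕ} (f : Fin n → V) (s : Fin n → Term V) {b : Term V} :
      Exposes t x k b → Exposes t x k (Term.letrec n f s b)
  | var {k : ℕ} {f : V} {d : Term V} :
      t.HasEquation f d → Exposes t x k d → Exposes t x k (Term.var f)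

open Classical in
/-- On a subterm of `t`: substitute `e` for all occurrences of `x`, and remove the abstraction `λx`
together with the application nodes, with their arguments, that are matched with it. (So a redex
`(λx. b) e` becomes `b[x := e]`.) -/
noncomputable def eliminate {V : Type u} (t : Term V) (x : V) (e : Term V) : Term V → Term V
  | Term.var v => if v = x then e else Term.var v
  | Term.lam v b => if v = x then eliminate t x e b else Term.lam v (eliminate t x e b)
  | Term.app p q =>
      if Exposes t x 0 p then eliminate t x e p
      else Term.app (eliminate t x e p) (eliminate t x e q)
  | Term.letrec n f s b => Term.letrec n f (fun i => eliminate t x e (s i)) (eliminate t x e b)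

/-- The transformation of the whole term `t`. -/
noncomputable def trans {V : Type u} (t : Term V) (x : V) (e : Term V) : Term V :=
  eliminate t x e t

end LetrecCalc

/-! Whether an abstraction `λx` in the unfolding meets an argument can be read off the spines of the
subterms of `t` (`Exposes`), and the types record these spines soundly: if a subterm exposes `λx` at
level `k`, then the `k`-th arrow of its type is annotated with `x` (`Infer.annAt_eq`). A single edge
`x ⇝ e` therefore means that every application matched with `λx` has the argument `e`, and that
neither `t` nor any argument, in particular not `e`, exposes `λx`. Only these facts, collected in
`SingleEdge`, are used afterwards.

The two routes are compared by coinduction. Thanks to unique naming, `T` can be described without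
substitution: `Env` reads subterms of `t` in an environment and looks up equations in `t` itself
(`Unfolds.env`). The invariant `Matches` links a stage `w` of the unfolding of `trans t x e` and a
stage `S` of the contraction of `T` through one subterm `s` of `t`: `w` is a reduct of the
eliminated `s`, and `S` is the unfolding of `s` in which the exposed `λx`, whose applications have
already been contracted, are removed. Crossing an eliminated application is one step of `S`;
crossing an eliminated `λx` or replacing `x` by `e` moves neither side; crossing a `letrec` or an
equation is one step of `w`. In all other cases the roots agree (`Kept`).

For each direction, the moves that the given reduction does not count must be finite in number. If
the unfolding is given, they consume the derivation of `Reduct` (`Config.exists_kept_or_step`); if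
the contraction is given, they consume those of `EnvHead` and `Remove` (`Config.progress`). Equality
of the results then follows from `Unfolds.unique`.

The delicate point is capture, since `trans` inserts `e` without renaming whereas contraction avoids
capture. A variable live in `e` and bound in `t` has its binder around every occurrence of `e`
(`core`). An argument `e` is met before the `λx` matched with it, so these binders have been passed
by then; the fields `cold`, `hot`, `fresh` and `quiet` of `Config` turn this into the statement that
the binders crossed later do not bind variables live in `e`. -/

namespace LetrecCalc

/-! ### The algebra of infinite terms -/

namespace ITerm

variable {V : Type u}

theorem dest_bvar (n : ℕ) :
    PFunctor.M.dest (bvar n : ITerm V) = ⟨Node.bvar n, fun c => Empty.elim c⟩ := rfl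

theorem dest_fvar (v : V) :
    PFunctor.M.dest (fvar v) = ⟨Node.fvar v, fun c => Empty.elim c⟩ := rfl

theorem dest_lam (v : V) (b : ITerm V) :
    PFunctor.M.dest (lam v b) = ⟨Node.lam v, fun _ => b⟩ := rfl

theorem dest_app (p q : ITerm V) :
    PFunctor.M.dest (app p q) = ⟨Node.app, fun c : Bool => if c then q else p⟩ := rfl

theorem dest_injective {S T : ITerm V} (h : PFunctor.M.dest S = PFunctor.M.dest T) : S = T := by
  rw [← PFunctor.M.mk_dest S, h, PFunctor.M.mk_dest]

theorem eq_of_dest_bvar {T : ITerm V} {n : ℕ} {ch : (Node.bvar n : Node V).Child → ITerm V}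
    (h : PFunctor.M.dest T = ⟨Node.bvar n, ch⟩) : T = bvar n := by
  apply dest_injective
  rw [h, dest_bvar]
  congr
  funext c
  exact Empty.elim c

theorem eq_of_dest_fvar {T : ITerm V} {v : V} {ch : (Node.fvar v : Node V).Child → ITerm V}
    (h : PFunctor.M.dest T = ⟨Node.fvar v, ch⟩) : T = fvar v := by
  apply dest_injective
  rw [h, dest_fvar]
  congr
  funext c
  exact Empty.elim c

theorem eq_of_dest_lam {T : ITerm V} {v : V} {ch : (Node.lam v : Node V).Child → ITerm V}
    (h : PFunctor.M.dest T = ⟨Node.lam v, ch⟩) : T = lam v (ch ()) := by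
  apply dest_injective
  rw [h, dest_lam]
  rfl

theorem eq_of_dest_app {T : ITerm V} {ch : (Node.app : Node V).Child → ITerm V}
    (h : PFunctor.M.dest T = ⟨Node.app, ch⟩) : T = app (ch false) (ch true) := by
  apply dest_injective
  rw [h, dest_app]
  congr
  funext c
  cases c <;> rfl

theorem exists_eq (T : ITerm V) : (∃ n, T = bvar n) ∨ (∃ v, T = fvar v) ∨ (∃ v M, T = lam v M) ∨
    ∃ P Q, T = app P Q := by
  rcases h : PFunctor.M.dest T with ⟨_ | _ | _ | _, ch⟩
  · exact Or.inl ⟨_, eq_of_dest_bvar h⟩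
  · exact Or.inr (Or.inl ⟨_, eq_of_dest_fvar h⟩)
  · exact Or.inr (Or.inr (Or.inl ⟨_, _, eq_of_dest_lam h⟩))
  · exact Or.inr (Or.inr (Or.inr ⟨_, _, eq_of_dest_app h⟩))

@[elab_as_elim]
theorem shapeCases {motive : ITerm V → Prop} (T : ITerm V) (bvar : ∀ n, motive (bvar n))
    (fvar : ∀ v, motive (fvar v)) (lam : ∀ v M, motive (lam v M))
    (app : ∀ P Q, motive (app P Q)) : motive T := by
  rcases exists_eq T with ⟨n, rfl⟩ | ⟨v, rfl⟩ | ⟨v, M, rfl⟩ | ⟨P, Q, rfl⟩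
  · exact bvar n
  · exact fvar v
  · exact lam v M
  · exact app P Q

theorem lam_injective {v w : V} {M N : ITerm V} (h : lam v M = lam w N) : v = w ∧ M = N := by
  have h' := congrArg PFunctor.M.dest h
  rw [dest_lam, dest_lam] at h'
  have h1 := congrArg Sigma.fst h'
  injection h1 with h1
  subst h1
  exact ⟨rfl, congrFun (eq_of_heq (Sigma.mk.inj h').2) ()⟩

theorem app_injective {P Q P' Q' : ITerm V} (h : app P Q = app P' Q') : P = P' ∧ Q = Q' := by
  have h' := congrArg PFunctor.M.dest h
  rw [dest_app, dest_app] at h'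
  have h1 := eq_of_heq (Sigma.mk.inj h').2
  exact ⟨congrFun h1 false, congrFun h1 true⟩

theorem lam_ne_app {v : V} {M P Q : ITerm V} : lam v M ≠ app P Q := fun h => by
  have h' := congrArg Sigma.fst (congrArg PFunctor.M.dest h)
  exact Node.noConfusion rfl (heq_of_eq h')

theorem bvar_ne_lam {n : ℕ} {v : V} {M : ITerm V} : bvar n ≠ lam v M := fun h => by
  have h' := congrArg Sigma.fst (congrArg PFunctor.M.dest h)
  exact Node.noConfusion rfl (heq_of_eq h')

theorem fvar_ne_lam {w v : V} {M : ITerm V} : fvar w ≠ lam v M := fun h => by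
  have h' := congrArg Sigma.fst (congrArg PFunctor.M.dest h)
  exact Node.noConfusion rfl (heq_of_eq h')

theorem bvar_ne_app {n : ℕ} {P Q : ITerm V} : bvar n ≠ app P Q := fun h => by
  have h' := congrArg Sigma.fst (congrArg PFunctor.M.dest h)
  exact Node.noConfusion rfl (heq_of_eq h')

theorem fvar_ne_app {w : V} {P Q : ITerm V} : fvar w ≠ app P Q := fun h => by
  have h' := congrArg Sigma.fst (congrArg PFunctor.M.dest h)
  exact Node.noConfusion rfl (heq_of_eq h')

/-- One layer of two terms with the same root and related immediate subterms. -/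
inductive Layer (R : ITerm V → ITerm V → Prop) : ITerm V → ITerm V → Prop
  | refl (T : ITerm V) : Layer R T T
  | lam (v : V) {M N : ITerm V} : R M N → Layer R (lam v M) (lam v N)
  | app {P Q P' Q' : ITerm V} : R P P' → R Q Q' → Layer R (app P Q) (app P' Q')

/-- Bisimulation up to equality: because of `Layer.refl`, the relation `R` need not contain the
diagonal. -/
theorem bisim (R : ITerm V → ITerm V → Prop) (h : ∀ S T, R S T → Layer R S T)
    {S T : ITerm V} (hST : R S T) : S = T := by
  refine PFunctor.M.bisim (fun S T => S = T ∨ R S T) ?_ S T (Or.inr hST)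
  rintro S T (rfl | hR)
  · exact ⟨_, _, _, rfl, rfl, fun _ => Or.inl rfl⟩
  · cases h S T hR with
    | refl => exact ⟨_, _, _, rfl, rfl, fun _ => Or.inl rfl⟩
    | lam v hM => exact ⟨_, _, _, dest_lam _ _, dest_lam _ _, fun _ => Or.inr hM⟩
    | app hP hQ =>
      refine ⟨_, _, _, dest_app _ _, dest_app _ _, fun c => ?_⟩
      cases c
      · exact Or.inr hP
      · exact Or.inr hQ

/-! ### Calculus of renaming and substitution. -/

theorem dest_rename (ξ : ℕ → ℕ) (T : ITerm V) : PFunctor.M.dest (rename ξ T) =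
    (sig V).map (PFunctor.M.corec renameStep) (renameStep (T, ξ)) :=
  PFunctor.M.dest_corec _ _

theorem dest_subst (θ : ℕ → ITerm V) (T : ITerm V) : PFunctor.M.dest (subst θ T) =
    (sig V).map (PFunctor.M.corec substStep) (substStep (T, θ)) :=
  PFunctor.M.dest_corec _ _

@[simp] theorem rename_bvar (ξ : ℕ → ℕ) (n : ℕ) : rename ξ (bvar n : ITerm V) = bvar (ξ n) :=
  eq_of_dest_bvar ((dest_rename _ _).trans rfl)

@[simp] theorem rename_fvar (ξ : ℕ → ℕ) (v : V) : rename ξ (fvar v) = fvar v :=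
  eq_of_dest_fvar ((dest_rename _ _).trans rfl)

@[simp] theorem rename_lam (ξ : ℕ → ℕ) (v : V) (M : ITerm V) :
    rename ξ (lam v M) = lam v (rename (liftRen ξ) M) :=
  eq_of_dest_lam (ch := fun _ => rename (liftRen ξ) M) ((dest_rename _ _).trans rfl)

@[simp] theorem rename_app (ξ : ℕ → ℕ) (P Q : ITerm V) :
    rename ξ (app P Q) = app (rename ξ P) (rename ξ Q) :=
  eq_of_dest_app (ch := fun c : Bool => rename ξ (if c then Q else P)) ((dest_rename _ _).trans rfl)

@[simp] theorem subst_fvar (θ : ℕ → ITerm V) (v : V) : subst θ (fvar v) = fvar v :=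
  eq_of_dest_fvar ((dest_subst _ _).trans rfl)

@[simp] theorem subst_lam (θ : ℕ → ITerm V) (v : V) (M : ITerm V) :
    subst θ (lam v M) = lam v (subst (liftSub θ) M) :=
  eq_of_dest_lam (ch := fun _ => subst (liftSub θ) M) ((dest_subst _ _).trans rfl)

@[simp] theorem subst_app (θ : ℕ → ITerm V) (P Q : ITerm V) :
    subst θ (app P Q) = app (subst θ P) (subst θ Q) :=
  eq_of_dest_app (ch := fun c : Bool => subst θ (if c then Q else P)) ((dest_subst _ _).trans rfl)

theorem liftSub_bvar : liftSub (bvar : ℕ → ITerm V) = bvar := by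
  funext n
  cases n with
  | zero => rfl
  | succ n => exact rename_bvar _ _

theorem subst_bvar_bvar (n : ℕ) : subst bvar (bvar n : ITerm V) = bvar n :=
  eq_of_dest_bvar ((dest_subst _ _).trans rfl)

-- Below the root of a substituted term `substStep` goes on with the substitution `bvar`. That this
-- copying is harmless is what makes `subst_bvar` true.
@[simp] theorem subst_id (T : ITerm V) : subst bvar T = T := by
  refine bisim (fun S T => S = subst bvar T) ?_ rfl
  rintro _ T rfl
  induction T using shapeCases with
  | bvar n => rw [subst_bvar_bvar]; exact .refl _
  | fvar v => rw [subst_fvar]; exact .refl _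
  | lam v M => rw [subst_lam, liftSub_bvar]; exact .lam v rfl
  | app P Q => rw [subst_app]; exact .app rfl rfl

@[simp] theorem subst_bvar (θ : ℕ → ITerm V) (n : ℕ) : subst θ (bvar n) = θ n := by
  apply dest_injective
  rw [dest_subst]
  have h : substStep ((bvar n : ITerm V), θ) =
    ⟨(PFunctor.M.dest (θ n)).1, fun c => ((PFunctor.M.dest (θ n)).2 c, bvar)⟩ := rfl
  rw [h]
  change (⟨_, fun c => subst bvar ((PFunctor.M.dest (θ n)).2 c)⟩ : (sig V) (ITerm V)) = _
  simp only [subst_id]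
  rfl

@[simp] theorem shift_bvar (n : ℕ) : shift (bvar n : ITerm V) = bvar (n + 1) := rename_bvar _ _

@[simp] theorem shift_fvar (v : V) : shift (fvar v) = fvar v := rename_fvar _ _

theorem rename_eq_subst (ξ : ℕ → ℕ) (T : ITerm V) :
    rename ξ T = subst (fun n => bvar (ξ n)) T := by
  refine bisim (fun X Y => ∃ ξ T, X = rename ξ T ∧ Y = subst (fun n => bvar (ξ n)) T) ?_
    ⟨ξ, T, rfl, rfl⟩
  rintro _ _ ⟨ξ, T, rfl, rfl⟩
  induction T using shapeCases with
  | bvar n => rw [rename_bvar, subst_bvar]; exact .refl _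
  | fvar v => rw [rename_fvar, subst_fvar]; exact .refl _
  | lam v M =>
    rw [rename_lam, subst_lam]
    refine .lam v ⟨liftRen ξ, M, rfl, ?_⟩
    congr 1
    funext n
    cases n with
    | zero => rfl
    | succ n => exact shift_bvar _
  | app P Q => rw [rename_app, subst_app]; exact .app ⟨_, _, rfl, rfl⟩ ⟨_, _, rfl, rfl⟩

theorem subst_rename (θ : ℕ → ITerm V) (ξ : ℕ → ℕ) (T : ITerm V) :
    subst θ (rename ξ T) = subst (fun n => θ (ξ n)) T := by
  refine bisim (fun X Y => ∃ θ ξ T, X = subst θ (rename ξ T) ∧ Y = subst (fun n => θ (ξ n)) T) ?_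
    ⟨θ, ξ, T, rfl, rfl⟩
  rintro _ _ ⟨θ, ξ, T, rfl, rfl⟩
  induction T using shapeCases with
  | bvar n => rw [rename_bvar, subst_bvar, subst_bvar]; exact .refl _
  | fvar v => rw [rename_fvar, subst_fvar, subst_fvar]; exact .refl _
  | lam v M =>
    rw [rename_lam, subst_lam, subst_lam]
    refine .lam v ⟨liftSub θ, liftRen ξ, M, rfl, ?_⟩
    congr 1
    funext n
    cases n <;> rfl
  | app P Q =>
    rw [rename_app, subst_app, subst_app]
    exact .app ⟨_, _, _, rfl, rfl⟩ ⟨_, _, _, rfl, rfl⟩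

theorem rename_rename (ξ ζ : ℕ → ℕ) (T : ITerm V) :
    rename ξ (rename ζ T) = rename (fun n => ξ (ζ n)) T := by
  rw [rename_eq_subst ξ, subst_rename, rename_eq_subst]

theorem rename_subst (ξ : ℕ → ℕ) (θ : ℕ → ITerm V) (T : ITerm V) :
    rename ξ (subst θ T) = subst (fun n => rename ξ (θ n)) T := by
  refine bisim (fun X Y => ∃ ξ θ T, X = rename ξ (subst θ T) ∧
    Y = subst (fun n => rename ξ (θ n)) T) ?_ ⟨ξ, θ, T, rfl, rfl⟩
  rintro _ _ ⟨ξ, θ, T, rfl, rfl⟩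
  induction T using shapeCases with
  | bvar n => rw [subst_bvar, subst_bvar]; exact .refl _
  | fvar v => rw [subst_fvar, subst_fvar, rename_fvar]; exact .refl _
  | lam v M =>
    rw [subst_lam, subst_lam, rename_lam]
    refine .lam v ⟨liftRen ξ, liftSub θ, M, rfl, ?_⟩
    congr 1
    funext n
    cases n with
    | zero => exact (rename_bvar (liftRen ξ) 0).symm
    | succ n => simp only [liftSub, shift, rename_rename, liftRen]
  | app P Q =>
    rw [subst_app, subst_app, rename_app]
    exact .app ⟨_, _, _, rfl, rfl⟩ ⟨_, _, _, rfl, rfl⟩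

theorem subst_liftSub_shift (θ : ℕ → ITerm V) (T : ITerm V) :
    subst (liftSub θ) (shift T) = shift (subst θ T) := by
  simp only [shift, subst_rename, rename_subst, liftSub]

theorem subst_subst (θ τ : ℕ → ITerm V) (T : ITerm V) :
    subst θ (subst τ T) = subst (fun n => subst θ (τ n)) T := by
  refine bisim (fun X Y => ∃ θ τ T, X = subst θ (subst τ T) ∧
    Y = subst (fun n => subst θ (τ n)) T) ?_ ⟨θ, τ, T, rfl, rfl⟩
  rintro _ _ ⟨θ, τ, T, rfl, rfl⟩
  induction T using shapeCases with
  | bvar n => rw [subst_bvar, subst_bvar]; exact .refl _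
  | fvar v => rw [subst_fvar, subst_fvar, subst_fvar]; exact .refl _
  | lam v M =>
    rw [subst_lam, subst_lam, subst_lam]
    refine .lam v ⟨liftSub θ, liftSub τ, M, rfl, ?_⟩
    congr 1
    funext n
    cases n with
    | zero => exact (subst_bvar (liftSub θ) 0).symm
    | succ n => exact (subst_liftSub_shift _ _).symm
  | app P Q =>
    rw [subst_app, subst_app, subst_app]
    exact .app ⟨_, _, _, rfl, rfl⟩ ⟨_, _, _, rfl, rfl⟩

/-- The substitution of `E` for the index `0`. -/
def single (E : ITerm V) : ℕ → ITerm V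
  | 0 => E
  | n + 1 => bvar n

theorem inst_eq (M E : ITerm V) : inst M E = subst (single E) M := by
  unfold inst
  congr 1

theorem subst_single_shift (E T : ITerm V) : subst (single E) (shift T) = T := by
  rw [shift, subst_rename]
  exact subst_id T

theorem subst_inst (θ : ℕ → ITerm V) (M E : ITerm V) :
    subst θ (inst M E) = inst (subst (liftSub θ) M) (subst θ E) := by
  simp only [inst_eq, subst_subst]
  congr 1
  funext n
  cases n with
  | zero => simp [single, liftSub]
  | succ n => simp [single, liftSub, subst_single_shift]

/-! ### Exposed abstractions of infinite terms -/

/-- `IExposes x n k P`: when `P` is given `k` arguments, the next one is matched with a `λx`,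
which is found `n` steps down the spine. -/
inductive IExposes (x : V) : ℕ → ℕ → ITerm V → Prop
  | hit (M : ITerm V) : IExposes x 0 0 (lam x M)
  | lam {n k : ℕ} {M : ITerm V} (y : V) : IExposes x n k M → IExposes x (n + 1) (k + 1) (lam y M)
  | app {n k : ℕ} {P : ITerm V} (Q : ITerm V) :
      IExposes x n (k + 1) P → IExposes x (n + 1) k (app P Q)

/-- No `λx` is exposed at any level. -/
def Inert (x : V) (P : ITerm V) : Prop := ∀ n k, ¬ IExposes x n k P

theorem inert_bvar (x : V) (n : ℕ) : Inert x (bvar n) := by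
  intro m k h
  generalize hT : bvar n = T at h
  cases h with
  | hit => exact bvar_ne_lam hT
  | lam => exact bvar_ne_lam hT
  | app => exact bvar_ne_app hT

theorem inert_fvar (x v : V) : Inert x (fvar v) := by
  intro m k h
  generalize hT : fvar v = T at h
  cases h with
  | hit => exact fvar_ne_lam hT
  | lam => exact fvar_ne_lam hT
  | app => exact fvar_ne_app hT

theorem IExposes.lam_inv {x y : V} {n k : ℕ} {M : ITerm V} (h : IExposes x n k (ITerm.lam y M)) :
    (y = x ∧ n = 0 ∧ k = 0) ∨ ∃ n' k', n = n' + 1 ∧ k = k' + 1 ∧ IExposes x n' k' M := by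
  generalize hT : ITerm.lam y M = T at h
  cases h with
  | hit => exact Or.inl ⟨(lam_injective hT).1, rfl, rfl⟩
  | lam z h => exact Or.inr ⟨_, _, rfl, rfl, (lam_injective hT).2 ▸ h⟩
  | app => exact absurd hT lam_ne_app

theorem IExposes.app_inv {x : V} {n k : ℕ} {P Q : ITerm V} (h : IExposes x n k (ITerm.app P Q)) :
    ∃ n', n = n' + 1 ∧ IExposes x n' (k + 1) P := by
  generalize hT : ITerm.app P Q = T at h
  cases h with
  | hit => exact absurd hT.symm lam_ne_app
  | lam => exact absurd hT.symm lam_ne_app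
  | app Q' h => exact ⟨_, rfl, (app_injective hT).1 ▸ h⟩

theorem IExposes.subst {x : V} {n k : ℕ} {P : ITerm V} (h : IExposes x n k P) :
    ∀ θ, IExposes x n k (subst θ P) := by
  induction h with
  | hit M => intro θ; rw [subst_lam]; exact .hit _
  | lam y _ ih => intro θ; rw [subst_lam]; exact .lam y (ih _)
  | app Q _ ih => intro θ; rw [subst_app]; exact .app _ (ih _)

/-- The term may be infinite, so the depth `n` on the spine serves as the induction measure. -/
theorem IExposes.of_rename {x : V} {n k : ℕ} {ξ : ℕ → ℕ} {P : ITerm V}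
    (h : IExposes x n k (rename ξ P)) : IExposes x n k P := by
  induction n generalizing k ξ P with
  | zero =>
    induction P using shapeCases with
    | bvar i => rw [rename_bvar] at h; exact absurd h (inert_bvar x _ _ _)
    | fvar v => rw [rename_fvar] at h; exact h
    | lam v M =>
      rw [rename_lam] at h
      rcases h.lam_inv with ⟨rfl, _, rfl⟩ | ⟨n', k', h1, _⟩
      · exact .hit _
      · exact absurd h1 (by omega)
    | app P Q =>
      rw [rename_app] at h
      obtain ⟨n', h1, _⟩ := h.app_inv
      exact absurd h1 (by omega)
  | succ n ih =>
    induction P using shapeCases with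
    | bvar i => rw [rename_bvar] at h; exact absurd h (inert_bvar x _ _ _)
    | fvar v => rw [rename_fvar] at h; exact h
    | lam v M =>
      rw [rename_lam] at h
      rcases h.lam_inv with ⟨rfl, h1, rfl⟩ | ⟨n', k', h1, rfl, h⟩
      · exact absurd h1 (by omega)
      · obtain rfl : n = n' := by omega
        exact .lam v (ih h)
    | app P Q =>
      rw [rename_app] at h
      obtain ⟨n', h1, h⟩ := h.app_inv
      obtain rfl : n = n' := by omega
      exact .app Q (ih h)

theorem Inert.shift {x : V} {P : ITerm V} (h : Inert x P) : Inert x (shift P) :=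
  fun n k h' => h n k h'.of_rename

/-- Inertness of the inserted terms is essential: otherwise the spine could continue into one of
them and find its `λx` there. -/
theorem IExposes.of_subst {x : V} {n k : ℕ} {θ : ℕ → ITerm V} {P : ITerm V}
    (hθ : ∀ i, Inert x (θ i)) (h : IExposes x n k (ITerm.subst θ P)) : IExposes x n k P := by
  induction n generalizing k θ P with
  | zero =>
    induction P using shapeCases with
    | bvar i => rw [subst_bvar] at h; exact absurd h (hθ i _ _)
    | fvar v => rw [subst_fvar] at h; exact h
    | lam v M =>
      rw [subst_lam] at h
      rcases h.lam_inv with ⟨rfl, _, rfl⟩ | ⟨n', k', h1, _⟩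
      · exact .hit _
      · exact absurd h1 (by omega)
    | app P Q =>
      rw [subst_app] at h
      obtain ⟨n', h1, _⟩ := h.app_inv
      exact absurd h1 (by omega)
  | succ n ih =>
    induction P using shapeCases with
    | bvar i => rw [subst_bvar] at h; exact absurd h (hθ i _ _)
    | fvar v => rw [subst_fvar] at h; exact h
    | lam v M =>
      rw [subst_lam] at h
      rcases h.lam_inv with ⟨rfl, h1, rfl⟩ | ⟨n', k', h1, rfl, h⟩
      · exact absurd h1 (by omega)
      · obtain rfl : n = n' := by omega
        refine .lam v (ih (fun i => ?_) h)
        cases i with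
        | zero => exact inert_bvar x 0
        | succ i => exact (hθ i).shift
    | app P Q =>
      rw [subst_app] at h
      obtain ⟨n', h1, h⟩ := h.app_inv
      obtain rfl : n = n' := by omega
      exact .app Q (ih hθ h)

theorem IExposes.of_inst {x : V} {n k : ℕ} {M E : ITerm V} (hE : Inert x E)
    (h : IExposes x n k (inst M E)) : IExposes x n k M := by
  rw [inst_eq] at h
  refine h.of_subst fun i => ?_
  cases i with
  | zero => exact hE
  | succ i => exact inert_bvar x i

theorem IExposes.inst {x : V} {n k : ℕ} {M : ITerm V} (h : IExposes x n k M) (E : ITerm V) :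
    IExposes x n k (inst M E) := by
  rw [inst_eq]
  exact h.subst _

/-! ### Simultaneous removal of exposed abstractions -/

/-- The levels below an abstraction. -/
def lower (σ : Set ℕ) : Set ℕ := {k | k + 1 ∈ σ}

/-- The levels in the function part of an application that is kept. -/
def raise (σ : Set ℕ) : Set ℕ := {k | ∃ j ∈ σ, k = j + 1}

/-- `Remove x σ E P R`: the term `R` results from `P` by removing the abstractions `λx` that are
exposed at the levels in `σ`, and substituting `E` for their variables. -/
inductive Remove (x : V) : Set ℕ → ITerm V → ITerm V → ITerm V → Prop
  | done (E P : ITerm V) : Remove x ∅ E P P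
  | hit {σ : Set ℕ} {E M R : ITerm V} :
      0 ∈ σ → Remove x (lower σ) E (inst M E) R → Remove x σ E (lam x M) R
  | skip {σ : Set ℕ} {E M R : ITerm V} (y : V) :
      0 ∉ σ → Remove x (lower σ) (shift E) M R → Remove x σ E (lam y M) (lam y R)
  | app {σ : Set ℕ} {E P R : ITerm V} (Q : ITerm V) :
      Remove x (raise σ) E P R → Remove x σ E (app P Q) (app R Q)

theorem lower_empty : lower ∅ = ∅ := rfl

theorem raise_empty : raise ∅ = ∅ := by
  ext k
  simp [raise]

theorem zero_notMem_raise (σ : Set ℕ) : 0 ∉ raise σ := by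
  rintro ⟨j, _, h⟩
  exact absurd h (by omega)

theorem succ_mem_raise {σ : Set ℕ} {k : ℕ} : k + 1 ∈ raise σ ↔ k ∈ σ := by
  constructor
  · rintro ⟨j, hj, h⟩
    obtain rfl : k = j := by omega
    exact hj
  · exact fun h => ⟨k, h, rfl⟩

theorem Remove.lam_inv {x y : V} {σ : Set ℕ} {E M R : ITerm V}
    (h : Remove x σ E (ITerm.lam y M) R) :
    (0 ∈ σ ∧ y = x ∧ Remove x (lower σ) E (inst M E) R) ∨
    (0 ∉ σ ∧ ∃ R', R = ITerm.lam y R' ∧ Remove x (lower σ) (shift E) M R') := by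
  generalize hT : ITerm.lam y M = T at h
  cases h with
  | done => subst hT; exact Or.inr ⟨fun h => h, M, rfl, lower_empty ▸ .done _ _⟩
  | hit h0 h =>
    obtain ⟨rfl, rfl⟩ := lam_injective hT
    exact Or.inl ⟨h0, rfl, h⟩
  | skip z h0 h =>
    obtain ⟨rfl, rfl⟩ := lam_injective hT
    exact Or.inr ⟨h0, _, rfl, h⟩
  | app => exact absurd hT lam_ne_app

theorem Remove.app_inv {x : V} {σ : Set ℕ} {E P Q R : ITerm V}
    (h : Remove x σ E (ITerm.app P Q) R) :
    ∃ R', R = ITerm.app R' Q ∧ Remove x (raise σ) E P R' := by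
  generalize hT : ITerm.app P Q = T at h
  cases h with
  | done => subst hT; exact ⟨P, rfl, by rw [raise_empty]; exact .done _ _⟩
  | hit => exact absurd hT.symm lam_ne_app
  | skip => exact absurd hT.symm lam_ne_app
  | app Q' h =>
    obtain ⟨rfl, rfl⟩ := app_injective hT
    exact ⟨_, rfl, h⟩

theorem Remove.eq_of_empty {x : V} {σ : Set ℕ} {E P R : ITerm V} (h : Remove x σ E P R)
    (hσ : σ = ∅) : R = P := by
  induction h with
  | done => rfl
  | hit h0 => subst hσ; exact absurd h0 (Set.notMem_empty _)
  | skip y _ _ ih => rw [ih (by rw [hσ, lower_empty])]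
  | app Q _ ih => rw [ih (by rw [hσ, raise_empty])]

/-- Substitution commutes with each contraction (`subst_inst`). This is needed when a further `λx`
is contracted above removals that have already been made in its body. -/
theorem Remove.subst {x : V} {σ : Set ℕ} {E P R : ITerm V} (h : Remove x σ E P R) :
    ∀ θ, Remove x σ (subst θ E) (subst θ P) (subst θ R) := by
  induction h with
  | done => intro θ; exact .done _ _
  | hit h0 _ ih =>
    intro θ
    rw [subst_lam]
    exact .hit h0 (subst_inst θ _ _ ▸ ih θ)
  | skip y h0 _ ih =>
    intro θ
    rw [subst_lam, subst_lam]
    exact .skip y h0 (subst_liftSub_shift θ _ ▸ ih _)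
  | app Q _ ih =>
    intro θ
    rw [subst_app, subst_app]
    exact .app _ (ih θ)

open Classical in
/-- The number of levels below `j` that are not in `σ`. -/
noncomputable def remaining : Set ℕ → ℕ → ℕ
  | _, 0 => 0
  | σ, j + 1 => remaining (lower σ) j + if 0 ∈ σ then 0 else 1

theorem remaining_zero (σ : Set ℕ) : remaining σ 0 = 0 := rfl

theorem remaining_succ_of_mem {σ : Set ℕ} (h : 0 ∈ σ) (j : ℕ) :
    remaining σ (j + 1) = remaining (lower σ) j := by
  simp [remaining, h]

theorem remaining_succ_of_notMem {σ : Set ℕ} (h : 0 ∉ σ) (j : ℕ) :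
    remaining σ (j + 1) = remaining (lower σ) j + 1 := by
  simp [remaining, h]

theorem remaining_empty (j : ℕ) : remaining ∅ j = j := by
  induction j with
  | zero => rfl
  | succ j ih => rw [remaining_succ_of_notMem (Set.notMem_empty _), lower_empty, ih]

theorem lower_raise (σ : Set ℕ) : lower (raise σ) = σ := by
  ext k
  exact succ_mem_raise

theorem remaining_raise_succ (σ : Set ℕ) (j : ℕ) :
    remaining (raise σ) (j + 1) = remaining σ j + 1 := by
  rw [remaining_succ_of_notMem (zero_notMem_raise σ), lower_raise]

theorem lower_insert_zero (σ : Set ℕ) : lower (insert 0 σ) = lower σ := by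
  ext k
  simp [lower]

theorem lower_insert_succ (σ : Set ℕ) (j : ℕ) :
    lower (insert (j + 1) σ) = insert j (lower σ) := by
  ext k
  simp [lower]

theorem raise_insert (σ : Set ℕ) (j : ℕ) : raise (insert j σ) = insert (j + 1) (raise σ) := by
  ext k
  cases k with
  | zero => simp [zero_notMem_raise]
  | succ k => simp [succ_mem_raise]

/-- One more exposed abstraction can be removed by a contraction. -/
theorem Remove.exists_contract {x : V} {n j : ℕ} {σ : Set ℕ} {E P R : ITerm V}
    (hP : IExposes x n j P) (h : Remove x σ E P R) (hj : j ∉ σ) :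
    ∃ R', Contract x (remaining σ j) E R R' ∧ Remove x (insert j σ) E P R' := by
  induction n generalizing j σ E P R with
  | zero =>
    cases hP with
    | hit M =>
      rcases h.lam_inv with ⟨h0, _⟩ | ⟨_, R', rfl, hM⟩
      · exact absurd h0 hj
      · refine ⟨ITerm.inst R' E, ?_, .hit (Set.mem_insert _ _) ?_⟩
        · rw [remaining_zero]
          exact .hit _ _
        · rw [lower_insert_zero]
          -- The earlier removals in the body used `shift E`; instantiating index `0` turns this
          -- back into `E`, so the order of the removals does not matter.
          have := hM.subst (single E)
          rwa [subst_single_shift, ← inst_eq, ← inst_eq] at this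
  | succ n ih =>
    cases hP with
    | lam y hM =>
      rcases h.lam_inv with ⟨h0, rfl, hR⟩ | ⟨h0, R', rfl, hR⟩
      -- The body is now `inst M E`, no longer a subterm, but its exposed `λx` is still `n` steps
      -- down the spine; hence the induction on depth.
      · obtain ⟨R', h1, h2⟩ := ih (hM.inst E) hR hj
        refine ⟨R', ?_, .hit (Set.mem_insert_of_mem _ h0) ?_⟩
        · rwa [remaining_succ_of_mem h0]
        · rwa [lower_insert_succ]
      · obtain ⟨R'', h1, h2⟩ := ih hM hR hj
        refine ⟨ITerm.lam y R'', ?_, .skip y ?_ ?_⟩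
        · rw [remaining_succ_of_notMem h0]
          exact .skip y h1
        · simpa using h0
        · rwa [lower_insert_succ]
    | app Q hP =>
      obtain ⟨R', rfl, hR⟩ := h.app_inv
      obtain ⟨R'', h1, h2⟩ := ih hP hR (by rwa [succ_mem_raise])
      rw [remaining_raise_succ] at h1
      exact ⟨_, .app Q h1, .app Q (by rwa [raise_insert])⟩

theorem Contract.exposes {x : V} {k : ℕ} {E P R : ITerm V} (h : Contract x k E P R) :
    ∃ n, IExposes x n k P := by
  induction h with
  | hit => exact ⟨0, .hit _⟩
  | skip y _ ih => exact ⟨_, .lam y ih.choose_spec⟩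
  | app Q _ ih => exact ⟨_, .app Q ih.choose_spec⟩

/-- A contraction that is possible after a removal comes from an exposed abstraction. -/
theorem Remove.exposes_of_exposes {x : V} {σ : Set ℕ} {E P R : ITerm V} (h : Remove x σ E P R)
    (hE : Inert x E) {n k : ℕ} (hR : IExposes x n k R) :
    ∃ m j, j ∉ σ ∧ remaining σ j = k ∧ IExposes x m j P := by
  induction h generalizing n k with
  | done E P =>
    exact ⟨n, k, Set.notMem_empty _, remaining_empty k, hR⟩
  | hit h0 _ ih =>
    obtain ⟨m, j, h1, h2, h3⟩ := ih hE hR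
    exact ⟨m + 1, j + 1, h1, by rwa [remaining_succ_of_mem h0], .lam x (h3.of_inst hE)⟩
  | skip y h0 _ ih =>
    rcases hR.lam_inv with ⟨rfl, _, rfl⟩ | ⟨n', k', _, rfl, hR'⟩
    · exact ⟨0, 0, h0, remaining_zero _, .hit _⟩
    · obtain ⟨m, j, h1, h2, h3⟩ := ih hE.shift hR'
      exact ⟨m + 1, j + 1, h1, by rw [remaining_succ_of_notMem h0, h2], .lam y h3⟩
  | @app σ E P R Q _ ih =>
    obtain ⟨n', _, hR⟩ := hR.app_inv
    obtain ⟨m, j, h1, h2, h3⟩ := ih hE hR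
    cases j with
    | zero => rw [remaining_zero] at h2; exact absurd h2 (by omega)
    | succ j =>
      rw [succ_mem_raise] at h1
      rw [remaining_raise_succ] at h2
      exact ⟨m + 1, j, h1, by omega, .app Q h3⟩

/-! ### Determinism of contraction -/

theorem Contract.lam_inv {x y : V} {k : ℕ} {E M R : ITerm V}
    (h : Contract x k E (ITerm.lam y M) R) : (k = 0 ∧ R = inst M E) ∨
    ∃ k' R', k = k' + 1 ∧ R = ITerm.lam y R' ∧ Contract x k' (ITerm.shift E) M R' := by
  generalize hT : ITerm.lam y M = T at h
  cases h with
  | hit =>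
    obtain ⟨rfl, rfl⟩ := lam_injective hT
    exact Or.inl ⟨rfl, rfl⟩
  | skip z h =>
    obtain ⟨rfl, rfl⟩ := lam_injective hT
    exact Or.inr ⟨_, _, rfl, rfl, h⟩
  | app => exact absurd hT lam_ne_app

theorem Contract.app_inv {x : V} {k : ℕ} {E P Q R : ITerm V}
    (h : Contract x k E (ITerm.app P Q) R) :
    ∃ R', R = ITerm.app R' Q ∧ Contract x (k + 1) E P R' := by
  generalize hT : ITerm.app P Q = T at h
  cases h with
  | hit => exact absurd hT.symm lam_ne_app
  | skip => exact absurd hT.symm lam_ne_app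
  | app Q' h =>
    obtain ⟨rfl, rfl⟩ := app_injective hT
    exact ⟨_, rfl, h⟩

theorem Contract.unique {x : V} {k : ℕ} {E P R R' : ITerm V} (h : Contract x k E P R)
    (h' : Contract x k E P R') : R = R' := by
  induction h generalizing R' with
  | hit E M =>
    rcases h'.lam_inv with ⟨_, rfl⟩ | ⟨_, _, h, _⟩
    · rfl
    · exact absurd h (by omega)
  | skip y _ ih =>
    rcases h'.lam_inv with ⟨h, _⟩ | ⟨_, R'', h, rfl, h''⟩
    · exact absurd h (by omega)
    · cases h
      rw [ih h'']
  | app Q _ ih =>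
    obtain ⟨R'', rfl, h''⟩ := h'.app_inv
    rw [ih h'']

theorem GBetaStep.unique {x : V} {S T T' : ITerm V} (h : GBetaStep x S T)
    (h' : GBetaStep x S T') : T = T' := by
  obtain ⟨h⟩ := h
  generalize hS : ITerm.app _ _ = S at h'
  obtain ⟨h'⟩ := h'
  obtain ⟨rfl, rfl⟩ := app_injective hS
  exact h.unique h'

theorem GBetaStep.app_inv {x : V} {P Q S : ITerm V} (h : GBetaStep x (app P Q) S) :
    Contract x 0 Q P S := by
  generalize hT : app P Q = T at h
  obtain ⟨h⟩ := h
  obtain ⟨rfl, rfl⟩ := app_injective hT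
  exact h

end ITerm

/-! ### Occurrences and their scopes -/

namespace Term

variable {V : Type u}

theorem Sub.trans {r s t : Term V} (h : Sub r s) (h' : Sub s t) : Sub r t := by
  induction h' generalizing r with
  | refl => exact h
  | lam v _ ih => exact .lam v (ih h)
  | appL q _ ih => exact .appL q (ih h)
  | appR p _ ih => exact .appR p (ih h)
  | letrecDef f b i _ ih => exact .letrecDef f b i (ih h)
  | letrecBody f s _ ih => exact .letrecBody f s (ih h)

/-- The number of nodes. -/
def size : Term V → ℕ
  | var _ => 1
  | lam _ b => size b + 1
  | app p q => size p + size q + 1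
  | letrec _ _ s b => ∑ i, size (s i) + size b + 1

theorem Sub.size_le {s t : Term V} (h : Sub s t) : s.size ≤ t.size := by
  induction h with
  | refl => exact le_rfl
  | lam v _ ih => rw [size]; omega
  | appL q _ ih => rw [size]; omega
  | appR p _ ih => rw [size]; omega
  | @letrecDef n f s b i _ ih =>
    have := Finset.single_le_sum (f := fun i => size (s i)) (fun _ _ => Nat.zero_le _)
      (Finset.mem_univ i)
    rw [size]
    omega
  | letrecBody f s _ ih => rw [size]; omega

/-- An application is larger than its argument. Consequently `e` contains no application that is
matched with `λx`, as the argument of such an application would be `e`. -/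
theorem not_sub_app {p q e : Term V} (h : Sub (app p q) e) : q ≠ e := by
  rintro rfl
  have := h.size_le
  rw [size] at this
  omega

theorem Sub.binders_sublist {s t : Term V} (h : Sub s t) : s.binders.Sublist t.binders := by
  induction h with
  | refl => exact .refl _
  | lam v _ ih => exact ih.cons v
  | appL q _ ih => exact ih.trans (List.sublist_append_left _ _)
  | appR p _ ih => exact ih.trans (List.sublist_append_right _ _)
  | letrecDef f b i _ ih =>
    refine ih.trans (List.Sublist.trans ?_ (List.sublist_append_right _ _))
    refine List.Sublist.trans ?_ (List.sublist_append_left _ _)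
    exact List.sublist_flatten_of_mem ((List.mem_ofFn' _ _).2 ⟨i, rfl⟩)
  | letrecBody f s _ ih =>
    exact ih.trans ((List.sublist_append_right _ _).trans (List.sublist_append_right _ _))

/-- `s` binds `v` at its root. -/
def Binds (v : V) : Term V → Prop
  | lam y _ => y = v
  | letrec _ f _ _ => v ∈ Set.range f
  | _ => False

theorem Binds.mem_binders {v : V} {s : Term V} (h : Binds v s) : v ∈ s.binders := by
  cases s with
  | var => exact h.elim
  | app => exact h.elim
  | lam y b => cases h; exact List.mem_cons_self
  | letrec n f s b => exact List.mem_append_left _ ((List.mem_ofFn' _ _).2 h)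

/-- `Scope e L s t`: there is an occurrence of `s` in `t` below binders of the variables in `L`.
The mark `none` records that the occurrence lies inside an argument of an application which is
equal to `e`. -/
inductive Scope (e : Term V) : Set (Option V) → Term V → Term V → Prop
  | refl (t : Term V) : Scope e ∅ t t
  | lam {L : Set (Option V)} {s b : Term V} (y : V) :
      Scope e L s b → Scope e (insert (some y) L) s (lam y b)
  | appL {L : Set (Option V)} {s p : Term V} (q : Term V) :
      Scope e L s p → Scope e L s (app p q)
  | appR {L : Set (Option V)} {s q : Term V} (p : Term V) :
      Scope e L s q → Scope e ({o | o = none ∧ q = e} ∪ L) s (app p q)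
  | letrecDef {L : Set (Option V)} {r : Term V} {n : ℕ} (f : Fin n → V) {s : Fin n → Term V}
      (b : Term V) (i : Fin n) :
      Scope e L r (s i) → Scope e (some '' Set.range f ∪ L) r (letrec n f s b)
  | letrecBody {L : Set (Option V)} {r : Term V} {n : ℕ} (f : Fin n → V) (s : Fin n → Term V)
      {b : Term V} :
      Scope e L r b → Scope e (some '' Set.range f ∪ L) r (letrec n f s b)

theorem Scope.sub {e s t : Term V} {L : Set (Option V)} (h : Scope e L s t) : Sub s t := by
  induction h with
  | refl => exact .refl _
  | lam v _ ih => exact .lam v ih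
  | appL q _ ih => exact .appL q ih
  | appR p _ ih => exact .appR p ih
  | letrecDef f b i _ ih => exact .letrecDef f b i ih
  | letrecBody f s _ ih => exact .letrecBody f s ih

theorem Sub.exists_scope {s t : Term V} (h : Sub s t) (e : Term V) : ∃ L, Scope e L s t := by
  induction h with
  | refl => exact ⟨_, .refl _⟩
  | lam v _ ih => exact ⟨_, .lam v ih.choose_spec⟩
  | appL q _ ih => exact ⟨_, .appL q ih.choose_spec⟩
  | appR p _ ih => exact ⟨_, .appR p ih.choose_spec⟩
  | letrecDef f b i _ ih => exact ⟨_, .letrecDef f b i ih.choose_spec⟩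
  | letrecBody f s _ ih => exact ⟨_, .letrecBody f s ih.choose_spec⟩

theorem Scope.trans {e r s t : Term V} {L L' : Set (Option V)} (h : Scope e L s t)
    (h' : Scope e L' r s) : Scope e (L ∪ L') r t := by
  induction h with
  | refl => rwa [Set.empty_union]
  | lam v _ ih => rw [Set.insert_union]; exact .lam v (ih h')
  | appL q _ ih => exact .appL q (ih h')
  | appR p _ ih => rw [Set.union_assoc]; exact .appR p (ih h')
  | letrecDef f b i _ ih => rw [Set.union_assoc]; exact .letrecDef f b i (ih h')
  | letrecBody f s _ ih => rw [Set.union_assoc]; exact .letrecBody f s (ih h')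

theorem Scope.sub_of_none_mem {e s t : Term V} {L : Set (Option V)} (h : Scope e L s t)
    (hL : none ∈ L) : Sub s e := by
  induction h with
  | refl => exact absurd hL (Set.notMem_empty _)
  | lam v _ ih => exact ih (by simpa using hL)
  | appL q _ ih => exact ih hL
  | appR p h ih =>
    rcases hL with ⟨_, rfl⟩ | hL
    · exact h.sub
    · exact ih hL
  | letrecDef f b i _ ih => exact ih (by simpa using hL)
  | letrecBody f s _ ih => exact ih (by simpa using hL)

theorem Scope.mem_or_mem_free {e s t : Term V} {L : Set (Option V)} (h : Scope e L s t) {v : V}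
    (hv : v ∈ s.free) : some v ∈ L ∨ v ∈ t.free := by
  induction h with
  | refl => exact Or.inr hv
  | lam y _ ih =>
    rcases ih hv with h | h
    · exact Or.inl (Set.mem_insert_of_mem _ h)
    · by_cases hy : v = y
      · exact Or.inl (hy ▸ Set.mem_insert _ _)
      · exact Or.inr ⟨h, hy⟩
  | appL q _ ih => exact (ih hv).imp_right Or.inl
  | appR p _ ih => exact (ih hv).imp Or.inr Or.inr
  | letrecDef f b i _ ih =>
    by_cases hf : v ∈ Set.range f
    · exact Or.inl (Or.inl ⟨v, hf, rfl⟩)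
    · exact (ih hv).imp Or.inr fun h => ⟨Or.inl (Set.mem_iUnion.2 ⟨i, h⟩), hf⟩
  | letrecBody f s _ ih =>
    by_cases hf : v ∈ Set.range f
    · exact Or.inl (Or.inl ⟨v, hf, rfl⟩)
    · exact (ih hv).imp Or.inr fun h => ⟨Or.inr h, hf⟩

/-- The binder of a variable in the scope of an occurrence. -/
theorem Scope.exists_binder {e s t : Term V} {L : Set (Option V)} (h : Scope e L s t) {v : V}
    (hv : some v ∈ L) :
    ∃ L' r, Scope e L' r t ∧ Binds v r ∧ L' ⊆ L ∧ ∀ w, Binds w r → some w ∈ L := by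
  induction h with
  | refl => exact absurd hv (Set.notMem_empty _)
  | lam y _ ih =>
    rcases hv with hv | hv
    · cases hv
      exact ⟨∅, _, .refl _, rfl, Set.empty_subset _, fun w hw => hw ▸ Set.mem_insert _ _⟩
    · obtain ⟨L', r, h1, h2, h3, h4⟩ := ih hv
      exact ⟨_, r, .lam y h1, h2, Set.insert_subset_insert h3, fun w hw => Or.inr (h4 w hw)⟩
  | appL q _ ih =>
    obtain ⟨L', r, h1, h2, h3, h4⟩ := ih hv
    exact ⟨_, r, .appL q h1, h2, h3, h4⟩
  | appR p _ ih =>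
    rcases hv with ⟨hv, _⟩ | hv
    · cases hv
    · obtain ⟨L', r, h1, h2, h3, h4⟩ := ih hv
      exact ⟨_, r, .appR p h1, h2, Set.union_subset_union_right _ h3, fun w hw => Or.inr (h4 w hw)⟩
  | letrecDef f b i _ ih =>
    rcases hv with ⟨v', hv, h⟩ | hv
    · cases h
      exact ⟨∅, _, .refl _, hv, Set.empty_subset _, fun w hw => Or.inl ⟨w, hw, rfl⟩⟩
    · obtain ⟨L', r, h1, h2, h3, h4⟩ := ih hv
      exact ⟨_, r, .letrecDef f b i h1, h2, Set.union_subset_union_right _ h3,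
        fun w hw => Or.inr (h4 w hw)⟩
  | letrecBody f s _ ih =>
    rcases hv with ⟨v', hv, h⟩ | hv
    · cases h
      exact ⟨∅, _, .refl _, hv, Set.empty_subset _, fun w hw => Or.inl ⟨w, hw, rfl⟩⟩
    · obtain ⟨L', r, h1, h2, h3, h4⟩ := ih hv
      exact ⟨_, r, .letrecBody f s h1, h2, Set.union_subset_union_right _ h3,
        fun w hw => Or.inr (h4 w hw)⟩

theorem Scope.mem_binders {e s t : Term V} {L : Set (Option V)} (h : Scope e L s t) {v : V}
    (hv : Binds v s) : v ∈ t.binders :=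
  h.sub.binders_sublist.subset hv.mem_binders

theorem exists_binds_of_mem_binders {v : V} {t : Term V} (h : v ∈ t.binders) :
    ∃ s, Sub s t ∧ Binds v s := by
  induction t with
  | var => cases h
  | lam y b ih =>
    rcases List.mem_cons.1 h with rfl | h
    · exact ⟨_, .refl _, rfl⟩
    · obtain ⟨s, h1, h2⟩ := ih h
      exact ⟨s, .lam y h1, h2⟩
  | app p q ihp ihq =>
    rcases List.mem_append.1 h with h | h
    · obtain ⟨s, h1, h2⟩ := ihp h
      exact ⟨s, .appL q h1, h2⟩
    · obtain ⟨s, h1, h2⟩ := ihq h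
      exact ⟨s, .appR p h1, h2⟩
  | letrec n f s b ihs ihb =>
    rcases List.mem_append.1 h with h | h
    · exact ⟨_, .refl _, (List.mem_ofFn' _ _).1 h⟩
    · rcases List.mem_append.1 h with h | h
      · obtain ⟨l, hl, h⟩ := List.mem_flatten.1 h
        obtain ⟨i, rfl⟩ := (List.mem_ofFn' _ _).1 hl
        obtain ⟨s, h1, h2⟩ := ihs i h
        exact ⟨s, .letrecDef f b i h1, h2⟩
      · obtain ⟨s', h1, h2⟩ := ihb h
        exact ⟨s', .letrecBody f s h1, h2⟩

/-- Two occurrences that part ways, or of which one lies properly inside the other, would contribute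
`v` twice to the duplicate-free list of binders. So not only the binder but also its place in `t` is
determined. -/
theorem Scope.unique_binder {e t : Term V} (ht : t.binders.Nodup) {v : V} {s s' : Term V}
    {L L' : Set (Option V)} (h : Scope e L s t) (h' : Scope e L' s' t) (hv : Binds v s)
    (hv' : Binds v s') : s = s' ∧ L = L' := by
  induction h generalizing s' L' with
  | refl t =>
    cases h' with
    | refl => exact ⟨rfl, rfl⟩
    | lam y h' =>
      cases hv
      exact absurd (h'.mem_binders hv') (List.nodup_cons.1 ht).1
    | appL => exact hv.elim
    | appR => exact hv.elim
    | letrecDef f b i h' =>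
      refine absurd ?_ (List.disjoint_of_nodup_append ht ((List.mem_ofFn' _ _).2 hv))
      exact List.mem_append_left _ (List.mem_flatten.2
        ⟨_, (List.mem_ofFn' _ _).2 ⟨i, rfl⟩, h'.mem_binders hv'⟩)
    | letrecBody f s h' =>
      refine absurd ?_ (List.disjoint_of_nodup_append ht ((List.mem_ofFn' _ _).2 hv))
      exact List.mem_append_right _ (h'.mem_binders hv')
  | lam y h ih =>
    cases h' with
    | refl =>
      cases hv'
      exact absurd (h.mem_binders hv) (List.nodup_cons.1 ht).1
    | lam _ h' =>
      obtain ⟨rfl, rfl⟩ := ih (List.nodup_cons.1 ht).2 h' hv hv'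
      exact ⟨rfl, rfl⟩
  | appL q h ih =>
    have ht' := List.nodup_append.1 ht
    cases h' with
    | refl => exact hv'.elim
    | appL _ h' => exact ih ht'.1 h' hv hv'
    | appR _ h' =>
      exact absurd rfl (ht'.2.2 _ (h.mem_binders hv) _ (h'.mem_binders hv'))
  | appR p h ih =>
    have ht' := List.nodup_append.1 ht
    cases h' with
    | refl => exact hv'.elim
    | appL _ h' =>
      exact absurd rfl (ht'.2.2 _ (h'.mem_binders hv') _ (h.mem_binders hv))
    | appR _ h' =>
      obtain ⟨rfl, rfl⟩ := ih ht'.2.1 h' hv hv'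
      exact ⟨rfl, rfl⟩
  | @letrecDef L r n f s b i h ih =>
    have ht1 := List.nodup_append.1 ht
    have ht2 := List.nodup_append.1 ht1.2.1
    have ht3 := List.nodup_flatten.1 ht2.1
    have hmem : v ∈ (List.ofFn fun i => binders (s i)).flatten := List.mem_flatten.2
        ⟨_, (List.mem_ofFn' _ _).2 ⟨i, rfl⟩, h.mem_binders hv⟩
    cases h' with
    | refl =>
      exact absurd rfl (ht1.2.2 _ ((List.mem_ofFn' _ _).2 hv') _ (List.mem_append_left _ hmem))
    | letrecDef _ _ j h' =>
      by_cases hij : i = j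
      · subst hij
        obtain ⟨rfl, rfl⟩ := ih (ht3.1 _ ((List.mem_ofFn' _ _).2 ⟨i, rfl⟩)) h' hv hv'
        exact ⟨rfl, rfl⟩
      · exfalso
        have hp := List.pairwise_ofFn.1 ht3.2
        rcases lt_or_gt_of_ne hij with hij | hij
        · exact hp hij (h.mem_binders hv) (h'.mem_binders hv')
        · exact hp hij (h'.mem_binders hv') (h.mem_binders hv)
    | letrecBody _ _ h' => exact absurd rfl (ht2.2.2 _ hmem _ (h'.mem_binders hv'))
  | @letrecBody L r n f s b h ih =>
    have ht1 := List.nodup_append.1 ht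
    have ht2 := List.nodup_append.1 ht1.2.1
    cases h' with
    | refl =>
      exact absurd rfl (ht1.2.2 _ ((List.mem_ofFn' _ _).2 hv') _
        (List.mem_append_right _ (h.mem_binders hv)))
    | letrecDef _ _ j h' =>
      exact absurd rfl (ht2.2.2 _ (List.mem_flatten.2
        ⟨_, (List.mem_ofFn' _ _).2 ⟨j, rfl⟩, h'.mem_binders hv'⟩) _ (h.mem_binders hv))
    | letrecBody _ _ h' =>
      obtain ⟨rfl, rfl⟩ := ih ht2.2.1 h' hv hv'
      exact ⟨rfl, rfl⟩

theorem Sub.unique_binder {t : Term V} (ht : t.binders.Nodup) {v : V} {s s' : Term V}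
    (h : Sub s t) (h' : Sub s' t) (hv : Binds v s) (hv' : Binds v s') : s = s' := by
  obtain ⟨L, h⟩ := h.exists_scope t
  obtain ⟨L', h'⟩ := h'.exists_scope t
  exact (h.unique_binder ht h' hv hv').1

theorem Sub.injective_of_nodup {t : Term V} (ht : t.binders.Nodup) {n : ℕ} {f : Fin n → V}
    {s : Fin n → Term V} {b : Term V} (h : Sub (.letrec n f s b) t) : Function.Injective f :=
  List.nodup_ofFn.1 (List.nodup_append.1 (h.binders_sublist.nodup ht)).1

theorem HasEquation.unique {t : Term V} (ht : t.binders.Nodup) {f : V} {d d' : Term V}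
    (h : t.HasEquation f d) (h' : t.HasEquation f d') : d = d' := by
  obtain ⟨n, g, s, b, i, hs, rfl, rfl⟩ := h
  obtain ⟨n', g', s', b', i', hs', hi, rfl⟩ := h'
  have := hs.unique_binder ht hs' ⟨i, rfl⟩ ⟨i', hi⟩
  injection this with h1 h2 h3 h4
  subst h1
  cases h2
  cases h3
  rw [hs'.injective_of_nodup ht hi]

theorem HasEquation.mem_binders {t : Term V} {f : V} {d : Term V} (h : t.HasEquation f d) :
    f ∈ t.binders := by
  obtain ⟨n, g, s, b, i, hs, rfl, rfl⟩ := h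
  exact hs.binders_sublist.subset (Binds.mem_binders (s := letrec n g s b) ⟨i, rfl⟩)

theorem Sub.not_hasEquation {t : Term V} (ht : t.binders.Nodup) {y : V} {b : Term V}
    (h : Sub (.lam y b) t) (d : Term V) : ¬ t.HasEquation y d := by
  rintro ⟨n, g, s, b', i, hs, hi, rfl⟩
  have := h.unique_binder ht hs (v := y) rfl ⟨i, hi⟩
  cases this

theorem Sub.hasEquation {t : Term V} {n : ℕ} {f : Fin n → V} {s : Fin n → Term V} {b : Term V}
    (h : Sub (.letrec n f s b) t) (i : Fin n) : t.HasEquation (f i) (s i) :=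
  ⟨n, f, s, b, i, h, rfl, rfl⟩

/-- From an occurrence of a variable bound by an equation, the right-hand side of the equation is
found in a smaller scope. -/
theorem Scope.exists_definition {e t : Term V} (ht : t.WellNamed) {f : V} {d : Term V}
    (hf : t.HasEquation f d) {L : Set (Option V)} (h : Scope e L (var f) t) :
    some f ∈ L ∧ ∃ L' ⊆ L, Scope e L' d t := by
  have hfL : some f ∈ L :=
    (h.mem_or_mem_free (v := f) rfl).resolve_right fun h => ht.2 f h hf.mem_binders
  refine ⟨hfL, ?_⟩
  obtain ⟨L', r, h1, h2, h3, h4⟩ := h.exists_binder hfL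
  obtain ⟨n, g, s, b, i, hs, rfl, rfl⟩ := hf
  obtain rfl := h1.sub.unique_binder ht.1 hs h2 ⟨i, rfl⟩
  refine ⟨_, ?_, h1.trans (.letrecDef g b i (.refl _))⟩
  rw [Set.union_empty]
  refine Set.union_subset h3 ?_
  rintro _ ⟨w, hw, rfl⟩
  exact h4 w hw

/-- The variable `v`, not bound by an equation, occurs free in the unfolding of `s`. -/
inductive Live (t : Term V) (v : V) : Term V → Prop
  | var : (∀ d, ¬ t.HasEquation v d) → Live t v (var v)
  | lam {y : V} {b : Term V} : v ≠ y → Live t v b → Live t v (lam y b)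
  | appL {p : Term V} (q : Term V) : Live t v p → Live t v (app p q)
  | appR {q : Term V} (p : Term V) : Live t v q → Live t v (app p q)
  | letrec {n : ℕ} (f : Fin n → V) (s : Fin n → Term V) {b : Term V} :
      Live t v b → Live t v (letrec n f s b)
  | jump {f : V} {d : Term V} : t.HasEquation f d → Live t v d → Live t v (Term.var f)

theorem Live.not_hasEquation {t s : Term V} {v : V} (h : Live t v s) (d : Term V) :
    ¬ t.HasEquation v d := by
  induction h with
  | var h => exact h d
  | _ => assumption

/-- Following an equation leads to a smaller scope, so a variable found after any number of jumps
was already in scope at the start. -/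
theorem Live.mem_or_mem_free {e t s : Term V} (ht : t.WellNamed) {v : V} (h : Live t v s)
    {L : Set (Option V)} (hs : Scope e L s t) : some v ∈ L ∨ v ∈ t.free := by
  induction h generalizing L with
  | var _ => exact hs.mem_or_mem_free rfl
  | lam hy _ ih =>
    refine (ih (hs.trans (.lam _ (.refl _)))).imp_left fun h => ?_
    simpa [hy] using h
  | appL q _ ih => exact (ih (hs.trans (.appL q (.refl _)))).imp_left fun h => by simpa using h
  | appR p _ ih => exact (ih (hs.trans (.appR p (.refl _)))).imp_left fun h => by simpa using h
  | letrec f s h ih =>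
    refine (ih (hs.trans (.letrecBody f s (.refl _)))).imp_left fun h' => ?_
    rcases h' with h' | ⟨_, ⟨i, rfl⟩, h'⟩ | h'
    · exact h'
    · cases h'
      exact absurd (hs.sub.hasEquation i) (h.not_hasEquation _)
    · exact absurd h' (Set.notMem_empty _)
  | jump hf _ ih =>
    obtain ⟨_, L', hL', hd⟩ := hs.exists_definition ht hf
    exact (ih hd).imp_left fun h => hL' h

theorem mem_free_or_mem_binders {v : V} {t : Term V} (h : Sub (var v) t) :
    v ∈ t.free ∨ v ∈ t.binders := by
  obtain ⟨L, h⟩ := h.exists_scope t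
  rcases h.mem_or_mem_free (v := v) rfl with hv | hv
  · obtain ⟨_, r, h1, h2, _⟩ := h.exists_binder hv
    exact Or.inr (h1.mem_binders h2)
  · exact Or.inl hv

end Term

variable {V : Type u}

/-! ### Soundness of the binding graph -/

/-- The annotation of the arrow at level `k` of the spine of a type. -/
def AType.annAt : AType V → ℕ → Option V
  | base _, _ => none
  | arr a _ _, 0 => a
  | arr _ _ b, k + 1 => annAt b k

theorem AType.mem_blackholes {x : V} {S : AType V} {k : ℕ} (h : S.annAt k = some x) :
    (x, none) ∈ blackholes S := by
  induction S generalizing k with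
  | base => cases h
  | arr a T S _ ih =>
    cases k with
    | zero =>
      cases h
      exact Or.inr rfl
    | succ k =>
      have := ih h
      cases a with
      | none => exact this
      | some y => exact Or.inl this

/-- `Exposes`, with the height of its derivation. -/
inductive ExposesIn (t : Term V) (x : V) : ℕ → ℕ → Term V → Prop
  | hit {m : ℕ} (b : Term V) : ExposesIn t x m 0 (Term.lam x b)
  | lam {m k : ℕ} {b : Term V} (y : V) :
      ExposesIn t x m k b → ExposesIn t x (m + 1) (k + 1) (Term.lam y b)
  | app {m k : ℕ} {p : Term V} (q : Term V) :
      ExposesIn t x m (k + 1) p → ExposesIn t x (m + 1) k (Term.app p q)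
  | letrec {m k n : ℕ} (f : Fin n → V) (s : Fin n → Term V) {b : Term V} :
      ExposesIn t x m k b → ExposesIn t x (m + 1) k (Term.letrec n f s b)
  | var {m k : ℕ} {f : V} {d : Term V} :
      t.HasEquation f d → ExposesIn t x m k d → ExposesIn t x (m + 1) k (Term.var f)

theorem Exposes.exists_height {t : Term V} {x : V} {k : ℕ} {s : Term V} (h : Exposes t x k s) :
    ∃ m, ExposesIn t x m k s := by
  induction h with
  | hit b => exact ⟨0, .hit b⟩
  | lam y _ ih => exact ⟨_, .lam y ih.choose_spec⟩
  | app q _ ih => exact ⟨_, .app q ih.choose_spec⟩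
  | letrec f s _ ih => exact ⟨_, .letrec f s ih.choose_spec⟩
  | var hf _ ih => exact ⟨_, .var hf ih.choose_spec⟩

/-- The types of the free variables of `s` account for what is exposed, with height below `m`, by
the equations of `t`. -/
def SoundBelow (t : Term V) (x : V) (m : ℕ) (Γ : V → Option (AType V)) (s : Term V) : Prop :=
  ∀ f ∈ s.free, ∀ T d, Γ f = some T → t.HasEquation f d →
    ∀ m' < m, ∀ k, ExposesIn t x m' k d → T.annAt k = some x

theorem SoundBelow.mono {t : Term V} {x : V} {m m' : ℕ} {Γ : V → Option (AType V)} {s : Term V}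
    (h : SoundBelow t x m Γ s) (hm : m' ≤ m) : SoundBelow t x m' Γ s :=
  fun f hf T d hT hd i hi => h f hf T d hT hd i (by omega)

open Classical in
theorem SoundBelow.abs {t : Term V} {x : V} {m : ℕ} {Γ : V → Option (AType V)} {y : V}
    {b : Term V} {T : Option (AType V)} (ht : t.binders.Nodup) (hs : Term.Sub (.lam y b) t)
    (h : SoundBelow t x m Γ (.lam y b)) : SoundBelow t x m (Function.update Γ y T) b := by
  intro f hf S d hS hd
  have hy : f ≠ y := by
    rintro rfl
    exact hs.not_hasEquation ht d hd
  rw [Function.update_of_ne hy] at hS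
  exact h f ⟨hf, hy⟩ S d hS hd

/-- Inside a `letrec`, soundness is inherited if the right-hand sides have sound types. -/
theorem SoundBelow.extend {t : Term V} {x : V} {Γ : V → Option (AType V)} {n : ℕ}
    {f : Fin n → V} {s : Fin n → Term V} {b : Term V} {T : Fin n → AType V}
    (ht : t.binders.Nodup) (hs : Term.Sub (.letrec n f s b) t)
    (hT : ∀ i m, SoundBelow t x m (Function.extend f (fun j => some (T j)) Γ) (s i) →
      ∀ k, ExposesIn t x m k (s i) → (T i).annAt k = some x) (m : ℕ)
    (h : SoundBelow t x m Γ (.letrec n f s b)) {r : Term V}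
    (hr : ∀ v ∈ r.free, v ∈ Set.range f ∨ v ∈ (Term.letrec n f s b).free) :
    SoundBelow t x m (Function.extend f (fun j => some (T j)) Γ) r := by
  have hinj := hs.injective_of_nodup ht
  -- The types of the equations depend on one another. A jump into an equation costs one unit of
  -- height, so soundness below `m` for a right-hand side yields what is required of its name below
  -- `m + 1`.
  induction m generalizing r with
  | zero => exact fun _ _ _ _ _ _ m' hm' => absurd hm' (Nat.not_lt_zero _)
  | succ m ih =>
    intro g hg S d hS hd m' hm' k hk
    by_cases hgr : ∃ i, f i = g
    · obtain ⟨i, rfl⟩ := hgr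
      rw [hinj.extend_apply] at hS
      cases hS
      obtain rfl := hd.unique ht (hs.hasEquation i)
      refine hT i m' ((ih (h.mono (Nat.le_succ m)) (r := s i) fun v hv => ?_).mono (by omega)) k hk
      by_cases hvf : v ∈ Set.range f
      · exact Or.inl hvf
      · exact Or.inr ⟨Or.inl (Set.mem_iUnion.2 ⟨i, hv⟩), hvf⟩
    · rw [Function.extend_apply' _ _ _ hgr] at hS
      exact h g ((hr g hg).resolve_left hgr) S d hS hd m' hm' k hk

theorem Term.mem_free_letrec_def {n : ℕ} {f : Fin n → V} {s : Fin n → Term V} {b : Term V}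
    (i : Fin n) (v : V) (hv : v ∈ (s i).free) :
    v ∈ Set.range f ∨ v ∈ (Term.letrec n f s b).free := by
  by_cases hvf : v ∈ Set.range f
  · exact Or.inl hvf
  · exact Or.inr ⟨Or.inl (Set.mem_iUnion.2 ⟨i, hv⟩), hvf⟩

theorem Term.mem_free_letrec_body {n : ℕ} {f : Fin n → V} {s : Fin n → Term V} {b : Term V}
    (v : V) (hv : v ∈ b.free) : v ∈ Set.range f ∨ v ∈ (Term.letrec n f s b).free := by
  by_cases hvf : v ∈ Set.range f
  · exact Or.inl hvf
  · exact Or.inr ⟨Or.inr hv, hvf⟩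

/-- The typing rules follow the spine: an abstraction adds an arrow annotated with its variable, an
application strips one, and a `letrec` passes on the type of its body. The circularity through
equations is broken by the height of the exposure. -/
theorem Infer.annAt_eq {t : Term V} {x : V} (ht : t.binders.Nodup) {B : Edges V}
    {Γ : V → Option (AType V)} {s : Term V} {S : AType V} (h : Infer B Γ s S)
    (hs : Term.Sub s t) {m : ℕ} (hΓ : SoundBelow t x m Γ s) {k : ℕ}
    (hk : ExposesIn t x m k s) : S.annAt k = some x := by
  induction h generalizing m k with
  | var hv =>
    cases hk with
    | var hf hd => exact hΓ _ rfl _ _ hv hf _ (Nat.lt_succ_self _) _ hd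
  | abs hb ih =>
    cases hk with
    | hit => rfl
    | lam _ hk =>
      exact ih (Term.Sub.trans (.lam _ (.refl _)) hs)
        ((hΓ.abs ht hs).mono (Nat.le_succ _)) hk
  | app hp hq hTR ihp ihq =>
    cases hk with
    | app _ hk =>
      exact ihp (Term.Sub.trans (.appL _ (.refl _)) hs) (m := _)
        (fun f hf T d hT hd i hi => hΓ f (Or.inl hf) T d hT hd i (by omega)) hk
  | letrec hdef hbody ihdef ihbody =>
    cases hk with
    | letrec _ _ hk =>
      refine ihbody (Term.Sub.trans (.letrecBody _ _ (.refl _)) hs) ?_ hk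
      exact SoundBelow.extend ht hs
        (fun i m h k hk => ihdef i (Term.Sub.trans (.letrecDef _ _ i (.refl _)) hs) h hk) _
        (hΓ.mono (Nat.le_succ _)) Term.mem_free_letrec_body

/-- What the edges of a binding graph say about the applications in a term. -/
theorem Infer.app_edges {t : Term V} {x : V} (ht : t.binders.Nodup) {B : Edges V}
    {Γ : V → Option (AType V)} {s : Term V} {S : AType V} (h : Infer B Γ s S)
    (hs : Term.Sub s t) (hΓ : ∀ m, SoundBelow t x m Γ s) {p q : Term V}
    (hpq : Term.Sub (.app p q) s) :
    (Exposes t x 0 p → (x, some q) ∈ B) ∧ ∀ k, Exposes t x k q → (x, none) ∈ B := by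
  induction h with
  | var hv => cases hpq
  | abs hb ih =>
    cases hpq with
    | lam _ hpq =>
      exact ih (Term.Sub.trans (.lam _ (.refl _)) hs) (fun m => (hΓ m).abs ht hs) hpq
  | @app B₁ B₂ Γ ann T S R e₁ e₂ hp hq hTR ihp ihq =>
    have hs1 : Term.Sub e₁ t := Term.Sub.trans (.appL _ (.refl _)) hs
    have hs2 : Term.Sub e₂ t := Term.Sub.trans (.appR _ (.refl _)) hs
    have hΓ1 : ∀ m, SoundBelow t x m Γ e₁ := fun m f hf => hΓ m f (Or.inl hf)
    have hΓ2 : ∀ m, SoundBelow t x m Γ e₂ := fun m f hf => hΓ m f (Or.inr hf)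
    cases hpq with
    | refl =>
      constructor
      · intro h
        obtain ⟨m, h⟩ := h.exists_height
        have := hp.annAt_eq ht hs1 (hΓ1 m) h
        cases this
        exact Or.inl (Or.inr rfl)
      · intro k h
        obtain ⟨m, h⟩ := h.exists_height
        exact Or.inr (AType.mem_blackholes (hq.annAt_eq ht hs2 (hΓ2 m) h))
    | appL _ hpq =>
      obtain ⟨h1, h2⟩ := ihp hs1 hΓ1 hpq
      exact ⟨fun h => Or.inl (Or.inl (Or.inl (h1 h))),
        fun k h => Or.inl (Or.inl (Or.inl (h2 k h)))⟩
    | appR _ hpq =>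
      obtain ⟨h1, h2⟩ := ihq hs2 hΓ2 hpq
      exact ⟨fun h => Or.inl (Or.inl (Or.inr (h1 h))),
        fun k h => Or.inl (Or.inl (Or.inr (h2 k h)))⟩
  | @letrec n f s b Γ B₀ B S T hdef hbody ihdef ihbody =>
    have hsd : ∀ i, Term.Sub (s i) t := fun i => Term.Sub.trans (.letrecDef _ _ i (.refl _)) hs
    have hsb : Term.Sub b t := Term.Sub.trans (.letrecBody _ _ (.refl _)) hs
    have hext : ∀ {r : Term V} (m : ℕ),
        (∀ v ∈ r.free, v ∈ Set.range f ∨ v ∈ (Term.letrec n f s b).free) →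
        SoundBelow t x m (Function.extend f (fun j => some (T j)) Γ) r := fun m hr =>
      SoundBelow.extend ht hs (fun i m h k hk => (hdef i).annAt_eq ht (hsd i) h hk) m (hΓ m) hr
    cases hpq with
    | letrecDef _ _ i hpq =>
      obtain ⟨h1, h2⟩ := ihdef i (hsd i) (fun m => hext m (Term.mem_free_letrec_def i)) hpq
      exact ⟨fun h => Or.inr (Set.mem_iUnion.2 ⟨i, h1 h⟩),
        fun k h => Or.inr (Set.mem_iUnion.2 ⟨i, h2 k h⟩)⟩
    | letrecBody _ _ hpq =>
      obtain ⟨h1, h2⟩ := ihbody hsb (fun m => hext m Term.mem_free_letrec_body) hpq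
      exact ⟨fun h => Or.inl (h1 h), fun k h => Or.inl (h2 k h)⟩

theorem some_notMem_blackholes {x : V} {d : Term V} {S : AType V} :
    (x, some d) ∉ blackholes S := by
  induction S with
  | base => exact fun h => h
  | arr a T S _ ih =>
    cases a with
    | none => exact ih
    | some y =>
      rintro (h | h)
      · exact ih h
      · cases h

/-- Edges to terms arise only in the application rule. So `e` is an argument somewhere in `t`, and
shares the inertness of all arguments. -/
theorem Infer.exists_app {B : Edges V} {Γ : V → Option (AType V)} {s : Term V} {S : AType V}
    (h : Infer B Γ s S) {x : V} {d : Term V} (hd : (x, some d) ∈ B) :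
    ∃ p, Term.Sub (.app p d) s := by
  induction h with
  | var => cases hd
  | abs _ ih =>
    obtain ⟨p, hp⟩ := ih hd
    exact ⟨p, .lam _ hp⟩
  | @app B₁ B₂ Γ ann T S R e₁ e₂ _ _ _ ihp ihq =>
    rcases hd with ((hd | hd) | hd) | hd
    · obtain ⟨p, hp⟩ := ihp hd
      exact ⟨p, .appL _ hp⟩
    · obtain ⟨p, hp⟩ := ihq hd
      exact ⟨p, .appR _ hp⟩
    · cases ann with
      | none => cases hd
      | some y =>
        cases hd
        exact ⟨e₁, .refl _⟩
    · exact absurd hd some_notMem_blackholes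
  | letrec _ _ ihdef ihbody =>
    rcases hd with hd | hd
    · obtain ⟨p, hp⟩ := ihbody hd
      exact ⟨p, .letrecBody _ _ hp⟩
    · obtain ⟨i, hd⟩ := Set.mem_iUnion.1 hd
      obtain ⟨p, hp⟩ := ihdef i hd
      exact ⟨p, .letrecDef _ _ i hp⟩

/-- The situation of a variable `x` of `t` whose only possible value is `e`. -/
structure SingleEdge (t : Term V) (x : V) (e : Term V) : Prop where
  wellNamed : t.WellNamed
  abstracts : t.Abstracts x
  arg_eq : ∀ p q, Term.Sub (.app p q) t → Exposes t x 0 p → q = e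
  arg_inert : ∀ p q, Term.Sub (.app p q) t → ∀ k, ¬ Exposes t x k q
  inert : ∀ k, ¬ Exposes t x k t
  value_inert : ∀ k, ¬ Exposes t x k e

theorem SingleEdge.of_bindingGraph {t e : Term V} {x : V} (hnames : t.WellNamed)
    (hx : t.Abstracts x) {Γ : V → Option (AType V)} {G : Edges V} (hG : IsBindingGraph Γ t G)
    (hedge : ∀ d, (x, d) ∈ G ↔ d = some e) : SingleEdge t x e := by
  obtain ⟨B, S, h, rfl⟩ := hG
  -- A free variable of `t` has no equation in `t`, so any context is vacuously sound.
  have hΓ : ∀ m, SoundBelow t x m Γ t :=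
    fun m f hf T d _ hd => absurd hd.mem_binders (hnames.2 f hf)
  have harg : ∀ p q, Term.Sub (.app p q) t → ∀ k, ¬ Exposes t x k q := by
    intro p q hpq k hk
    have := (hedge none).1 (Or.inl ((h.app_edges hnames.1 (.refl _) hΓ hpq).2 k hk))
    cases this
  obtain ⟨p, hp⟩ : ∃ p, Term.Sub (.app p e) t := by
    rcases (hedge (some e)).2 rfl with he | he
    · exact h.exists_app he
    · exact absurd he some_notMem_blackholes
  refine ⟨hnames, hx, ?_, harg, ?_, harg p e hp⟩
  · intro p q hpq hp
    exact Option.some_injective _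
      ((hedge _).1 (Or.inl ((h.app_edges hnames.1 (.refl _) hΓ hpq).1 hp)))
  · intro k hk
    obtain ⟨m, hk⟩ := hk.exists_height
    have := (hedge none).1 (Or.inr (AType.mem_blackholes
      (h.annAt_eq hnames.1 (.refl _) (hΓ m) hk)))
    cases this

/-! ### Unfolding in an environment -/

open Classical in
/-- The environment below an abstraction over `y`. -/
noncomputable def push (ρ : V → ITerm V) (y : V) : V → ITerm V :=
  Function.update (fun v => (ρ v).shift) y (ITerm.bvar 0)

theorem push_self (ρ : V → ITerm V) (y : V) : push ρ y y = ITerm.bvar 0 := by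
  classical exact Function.update_self ..

theorem push_of_ne (ρ : V → ITerm V) {y v : V} (h : v ≠ y) : push ρ y v = (ρ v).shift := by
  classical exact Function.update_of_ne h ..

/-- One layer of the unfolding of a subterm of `t` in an environment, where a variable that is
bound by an equation of `t` is replaced by the right-hand side. -/
inductive EnvHead (t : Term V) (R : (V → ITerm V) → Term V → ITerm V → Prop)
    (ρ : V → ITerm V) : Term V → ITerm V → Prop
  | var {v : V} : (∀ d, ¬ t.HasEquation v d) → EnvHead t R ρ (.var v) (ρ v)
  | lam (y : V) {b : Term V} {M : ITerm V} :
      R (push ρ y) b M → EnvHead t R ρ (.lam y b) (ITerm.lam y M)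
  | app {p q : Term V} {P Q : ITerm V} :
      R ρ p P → R ρ q Q → EnvHead t R ρ (.app p q) (ITerm.app P Q)
  | letrec {n : ℕ} (f : Fin n → V) (s : Fin n → Term V) {b : Term V} {P : ITerm V} :
      EnvHead t R ρ b P → EnvHead t R ρ (.letrec n f s b) P
  | jump {f : V} {d : Term V} {P : ITerm V} :
      t.HasEquation f d → EnvHead t R ρ d P → EnvHead t R ρ (.var f) P

theorem EnvHead.mono {t : Term V} {R R' : (V → ITerm V) → Term V → ITerm V → Prop}
    (hR : ∀ ρ s P, R ρ s P → R' ρ s P) {ρ : V → ITerm V} {s : Term V} {P : ITerm V}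
    (h : EnvHead t R ρ s P) : EnvHead t R' ρ s P := by
  induction h with
  | var h => exact .var h
  | lam y h => exact .lam y (hR _ _ _ h)
  | app h h' => exact .app (hR _ _ _ h) (hR _ _ _ h')
  | letrec f s _ ih => exact .letrec f s ih
  | jump hf _ ih => exact .jump hf ih

/-- `Env t ρ s P`: the infinite term `P` is the unfolding of the subterm `s` of `t`, with the
variables that are not bound by equations interpreted by `ρ`. -/
def Env (t : Term V) (ρ : V → ITerm V) (s : Term V) (P : ITerm V) : Prop :=
  ∃ R : (V → ITerm V) → Term V → ITerm V → Prop,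
    (∀ ρ s P, R ρ s P → EnvHead t R ρ s P) ∧ R ρ s P

theorem Env.head {t : Term V} {ρ : V → ITerm V} {s : Term V} {P : ITerm V} (h : Env t ρ s P) :
    EnvHead t (Env t) ρ s P := by
  obtain ⟨R, hR, h⟩ := h
  exact (hR _ _ _ h).mono fun _ _ _ h => ⟨R, hR, h⟩

/-- Coinduction. -/
theorem Env.coind {t : Term V} (R : (V → ITerm V) → Term V → ITerm V → Prop)
    (hR : ∀ ρ s P, R ρ s P → EnvHead t R ρ s P) {ρ : V → ITerm V} {s : Term V} {P : ITerm V}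
    (h : R ρ s P) : Env t ρ s P := ⟨R, hR, h⟩

theorem Env.of_head {t : Term V} {ρ : V → ITerm V} {s : Term V} {P : ITerm V}
    (h : EnvHead t (Env t) ρ s P) : Env t ρ s P :=
  Env.coind (fun ρ s P => EnvHead t (Env t) ρ s P)
    (fun _ _ _ h => h.mono fun _ _ _ h => h.head) h

section Inversion

variable {t : Term V} {ρ : V → ITerm V} {P : ITerm V}

theorem Env.var_inv {v : V} (h : Env t ρ (.var v) P) (hv : ∀ d, ¬ t.HasEquation v d) :
    P = ρ v := by
  cases h.head with
  | var => rfl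
  | jump hf => exact absurd hf (hv _)

theorem Env.lam_inv {y : V} {b : Term V} (h : Env t ρ (.lam y b) P) :
    ∃ M, P = ITerm.lam y M ∧ Env t (push ρ y) b M := by
  cases h.head with
  | lam _ hb => exact ⟨_, rfl, hb⟩

theorem Env.app_inv {p q : Term V} (h : Env t ρ (.app p q) P) :
    ∃ P' Q, P = ITerm.app P' Q ∧ Env t ρ p P' ∧ Env t ρ q Q := by
  cases h.head with
  | app hp hq => exact ⟨_, _, rfl, hp, hq⟩

theorem Env.letrec_inv {n : ℕ} {f : Fin n → V} {s : Fin n → Term V} {b : Term V}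
    (h : Env t ρ (.letrec n f s b) P) : Env t ρ b P := by
  cases h.head with
  | letrec _ _ h => exact .of_head h

theorem Env.jump_inv (ht : t.binders.Nodup) {f : V} {d : Term V} (hf : t.HasEquation f d)
    (h : Env t ρ (.var f) P) : Env t ρ d P := by
  cases h.head with
  | var hv => exact absurd hf (hv _)
  | jump hf' h =>
    obtain rfl := hf.unique ht hf'
    exact .of_head h

end Inversion

/-- `EnvHead` is inductive, so finitely many `letrec`s and jumps precede the root of the unfolding.
Induction on it finds the common root, and the bisimulation takes care of the rest. -/
theorem Env.unique {t : Term V} (ht : t.binders.Nodup) {ρ : V → ITerm V} {s : Term V}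
    {P P' : ITerm V} (h : Env t ρ s P) (h' : Env t ρ s P') : P = P' := by
  refine ITerm.bisim (fun P P' => ∃ ρ s, Env t ρ s P ∧ Env t ρ s P') ?_ ⟨ρ, s, h, h'⟩
  rintro P P' ⟨ρ, s, h, h'⟩
  replace h := h.head
  induction h with
  | var hv =>
    obtain rfl := h'.var_inv hv
    exact .refl _
  | lam y h =>
    obtain ⟨M, rfl, hM⟩ := h'.lam_inv
    exact .lam y ⟨_, _, h, hM⟩
  | app h1 h2 =>
    obtain ⟨P', Q', rfl, h1', h2'⟩ := h'.app_inv
    exact .app ⟨_, _, h1, h1'⟩ ⟨_, _, h2, h2'⟩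
  | letrec f s _ ih => exact ih h'.letrec_inv
  | jump hf _ ih => exact ih (h'.jump_inv ht hf)

theorem Env.congr {t : Term V} {ρ ρ' : V → ITerm V} {s : Term V} {P : ITerm V}
    (h : Env t ρ s P) (hρ : ∀ v, Term.Live t v s → ρ v = ρ' v) : Env t ρ' s P := by
  refine Env.coind (fun ρ' s P => ∃ ρ, Env t ρ s P ∧ ∀ v, Term.Live t v s → ρ v = ρ' v) ?_
    ⟨ρ, h, hρ⟩
  rintro ρ' s P ⟨ρ, h, hρ⟩
  replace h := h.head
  induction h with
  | var hv => rw [hρ _ (.var hv)]; exact .var hv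
  | lam y h =>
    refine .lam y ⟨_, h, fun v hv => ?_⟩
    by_cases hy : v = y
    · rw [hy, push_self, push_self]
    · rw [push_of_ne _ hy, push_of_ne _ hy, hρ v (.lam hy hv)]
  | app h1 h2 =>
    exact .app ⟨_, h1, fun v hv => hρ v (.appL _ hv)⟩ ⟨_, h2, fun v hv => hρ v (.appR _ hv)⟩
  | letrec f s _ ih => exact .letrec f s (ih fun v hv => hρ v (.letrec f s hv))
  | jump hf _ ih => exact .jump hf (ih fun v hv => hρ v (.jump hf hv))

theorem Env.subst {t : Term V} {ρ : V → ITerm V} {s : Term V} {P : ITerm V}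
    (h : Env t ρ s P) (θ : ℕ → ITerm V) :
    Env t (fun v => ITerm.subst θ (ρ v)) s (ITerm.subst θ P) := by
  refine Env.coind (fun ρ' s P' => ∃ ρ P θ, ρ' = (fun v => ITerm.subst θ (ρ v)) ∧
    P' = ITerm.subst θ P ∧ Env t ρ s P) ?_ ⟨ρ, P, θ, rfl, rfl, h⟩
  rintro _ s _ ⟨ρ, P, θ, rfl, rfl, h⟩
  replace h := h.head
  induction h with
  | var hv => exact .var hv
  | lam y h =>
    rw [ITerm.subst_lam]
    refine .lam y ⟨push ρ y, _, ITerm.liftSub θ, ?_, rfl, h⟩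
    funext v
    by_cases hy : v = y
    · rw [hy, push_self, push_self, ITerm.subst_bvar]
      rfl
    · rw [push_of_ne _ hy, push_of_ne _ hy, ITerm.subst_liftSub_shift]
  | app h1 h2 =>
    rw [ITerm.subst_app]
    exact .app ⟨_, _, _, rfl, rfl, h1⟩ ⟨_, _, _, rfl, rfl, h2⟩
  | letrec f s _ ih => exact .letrec f s ih
  | jump hf _ ih => exact .jump hf ih

/-- If `y` is not live in `s`, its new value is never consulted, and going below `λy` merely shifts.
This is the form in which absence of capture is used when a value moves under an abstraction. -/
theorem Env.push {t : Term V} {ρ : V → ITerm V} {s : Term V} {P : ITerm V} {y : V}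
    (h : Env t ρ s P) (hy : ¬ Term.Live t y s) : Env t (push ρ y) s P.shift := by
  have h' := h.subst fun n => ITerm.bvar n.succ
  rw [← ITerm.rename_eq_subst] at h'
  refine h'.congr fun v hv => ?_
  rw [push_of_ne, ← ITerm.rename_eq_subst]
  · rfl
  · rintro rfl
    exact hy hv

-- A beta step on the unfolding amounts to an update of the environment.
open Classical in
theorem Env.inst {t : Term V} {ρ : V → ITerm V} {b : Term V} {M : ITerm V} {y : V}
    (h : Env t (LetrecCalc.push ρ y) b M) (E : ITerm V) :
    Env t (Function.update ρ y E) b (ITerm.inst M E) := by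
  rw [ITerm.inst_eq]
  convert h.subst (ITerm.single E) using 1
  funext v
  by_cases hy : v = y
  · rw [hy, push_self, Function.update_self, ITerm.subst_bvar]
    rfl
  · rw [push_of_ne _ hy, Function.update_of_ne hy, ITerm.subst_single_shift]

/-! ### Exposed abstractions of unfoldings -/

theorem Exposes.lam_inv {t : Term V} {x y : V} {k : ℕ} {b : Term V}
    (h : Exposes t x k (.lam y b)) : (k = 0 ∧ y = x) ∨ ∃ k', k = k' + 1 ∧ Exposes t x k' b := by
  cases h with
  | hit => exact Or.inl ⟨rfl, rfl⟩
  | lam _ h => exact Or.inr ⟨_, rfl, h⟩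

theorem Exposes.jump_inv {t : Term V} (ht : t.binders.Nodup) {x f : V} {k : ℕ} {d : Term V}
    (hf : t.HasEquation f d) (h : Exposes t x k (.var f)) : Exposes t x k d := by
  cases h with
  | var hf' h =>
    obtain rfl := hf.unique ht hf'
    exact h

theorem Exposes.unfolding {t : Term V} (ht : t.binders.Nodup) {x : V} {k : ℕ} {s : Term V}
    (h : Exposes t x k s) {ρ : V → ITerm V} {P : ITerm V} (hP : Env t ρ s P) :
    ∃ n, ITerm.IExposes x n k P := by
  induction h generalizing ρ P with
  | hit b =>
    obtain ⟨M, rfl, _⟩ := hP.lam_inv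
    exact ⟨0, .hit M⟩
  | lam y _ ih =>
    obtain ⟨M, rfl, hM⟩ := hP.lam_inv
    obtain ⟨n, h⟩ := ih hM
    exact ⟨_, .lam y h⟩
  | app q _ ih =>
    obtain ⟨P', Q, rfl, hP', _⟩ := hP.app_inv
    obtain ⟨n, h⟩ := ih hP'
    exact ⟨_, .app Q h⟩
  | letrec f s _ ih => exact ih hP.letrec_inv
  | var hf _ ih => exact ih (hP.jump_inv ht hf)

theorem ITerm.inert_push {x : V} {ρ : V → ITerm V} (hρ : ∀ v, ITerm.Inert x (ρ v)) (y v : V) :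
    ITerm.Inert x (push ρ y v) := by
  by_cases hy : v = y
  · rw [hy, push_self]
    exact ITerm.inert_bvar x 0
  · rw [push_of_ne _ hy]
    exact (hρ v).shift

/-- The outer induction on depth follows the spine of the unfolding; the inner one on `EnvHead`
crosses the `letrec`s and jumps that leave no trace there. Inert environments keep the spine from
entering a value. -/
theorem ITerm.IExposes.of_unfolding {t : Term V} {x : V} {n k : ℕ} {P : ITerm V}
    (h : ITerm.IExposes x n k P) {s : Term V} {ρ : V → ITerm V}
    (hρ : ∀ v, ITerm.Inert x (ρ v)) (hP : Env t ρ s P) : Exposes t x k s := by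
  induction n generalizing k P s ρ with
  | zero =>
    replace hP := hP.head
    induction hP with
    | var _ => exact absurd h (hρ _ _ _)
    | lam y _ =>
      rcases h.lam_inv with ⟨rfl, _, rfl⟩ | ⟨n', k', h1, _⟩
      · exact .hit _
      · exact absurd h1 (by omega)
    | app _ _ =>
      obtain ⟨n', h1, _⟩ := h.app_inv
      exact absurd h1 (by omega)
    | letrec f s _ ih => exact .letrec f s (ih h)
    | jump hf _ ih => exact .var hf (ih h)
  | succ n ih =>
    replace hP := hP.head
    induction hP with
    | var _ => exact absurd h (hρ _ _ _)
    | lam y hM =>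
      rcases h.lam_inv with ⟨rfl, h1, rfl⟩ | ⟨n', k', h1, rfl, h'⟩
      · exact absurd h1 (by omega)
      · obtain rfl : n = n' := by omega
        exact .lam y (ih h' (ITerm.inert_push hρ y) hM)
    | app hP _ =>
      obtain ⟨n', h1, h'⟩ := h.app_inv
      obtain rfl : n = n' := by omega
      exact .app _ (ih h' hρ hP)
    | letrec f s _ ih' => exact .letrec f s (ih' h)
    | jump hf _ ih' => exact .var hf (ih' h)

theorem Env.inert {t : Term V} {x : V} {ρ : V → ITerm V} (hρ : ∀ v, ITerm.Inert x (ρ v))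
    {s : Term V} {P : ITerm V} (h : Env t ρ s P) (hs : ∀ k, ¬ Exposes t x k s) :
    ITerm.Inert x P :=
  fun _ k hk => hs k (hk.of_unfolding hρ h)

/-! ### Reducts of subterms under unfolding -/

theorem Term.mem_free_subst {θ : V → Term V} {w : Term V} {v : V}
    (h : v ∈ (Term.subst θ w).free) : ∃ u ∈ w.free, v ∈ (θ u).free := by
  classical
  induction w generalizing θ with
  | var u => exact ⟨u, rfl, h⟩
  | lam y b ih =>
    obtain ⟨h, hy⟩ := h
    obtain ⟨u, hu, hv⟩ := ih h
    by_cases huy : u = y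
    · subst huy
      rw [Function.update_self] at hv
      exact absurd hv hy
    · rw [Function.update_of_ne huy] at hv
      exact ⟨u, ⟨hu, huy⟩, hv⟩
  | app p q ihp ihq =>
    rcases h with h | h
    · obtain ⟨u, hu, hv⟩ := ihp h
      exact ⟨u, Or.inl hu, hv⟩
    · obtain ⟨u, hu, hv⟩ := ihq h
      exact ⟨u, Or.inr hu, hv⟩
  | letrec n f s b ihs ihb =>
    obtain ⟨h, hf⟩ := h
    have key : ∀ {r : Term V}, (∃ u ∈ r.free,
        v ∈ (Function.extend f (fun j => var (f j)) θ u).free) →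
        ∃ u ∈ r.free, u ∉ Set.range f ∧ v ∈ (θ u).free := by
      rintro r ⟨u, hu, hv⟩
      by_cases huf : ∃ i, f i = u
      · have : Function.extend f (fun j => var (f j)) θ u = var u := by
          rw [Function.extend_def, dif_pos huf, huf.choose_spec]
        rw [this] at hv
        cases hv
        exact absurd huf hf
      · rw [Function.extend_apply' _ _ _ huf] at hv
        exact ⟨u, hu, huf, hv⟩
    rcases h with h | h
    · obtain ⟨i, h⟩ := Set.mem_iUnion.1 h
      obtain ⟨u, hu, huf, hv⟩ := key (ihs i h)
      exact ⟨u, ⟨Or.inl (Set.mem_iUnion.2 ⟨i, hu⟩), huf⟩, hv⟩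
    · obtain ⟨u, hu, huf, hv⟩ := key (ihb h)
      exact ⟨u, ⟨Or.inr hu, huf⟩, hv⟩

theorem Term.UnfoldStep.letrec_inv {n : ℕ} {f : Fin n → V} {s : Fin n → Term V} {b w : Term V}
    (h : Term.UnfoldStep (.letrec n f s b) w) :
    w = Term.subst (Function.extend f (fun i => .letrec n f s (s i)) .var) b := by
  cases h
  rfl

theorem Term.UnfoldStep.unique {u w w' : Term V} (h : Term.UnfoldStep u w)
    (h' : Term.UnfoldStep u w') : w = w' := by
  cases h
  exact h'.letrec_inv.symm

/-- Unfolding at the root captures no variables and frees none. -/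
theorem Term.mem_free_unfold {n : ℕ} {f : Fin n → V} {s : Fin n → Term V} {b : Term V} {v : V}
    (h : v ∈ (Term.subst (Function.extend f (fun i => .letrec n f s (s i)) .var) b).free) :
    v ∈ (Term.letrec n f s b).free := by
  classical
  obtain ⟨u, hu, hv⟩ := Term.mem_free_subst h
  by_cases huf : ∃ i, f i = u
  · rw [Function.extend_def, dif_pos huf] at hv
    obtain ⟨hv, hvf⟩ := hv
    refine ⟨Or.inl ?_, hvf⟩
    rcases hv with hv | hv
    · exact hv
    · exact Set.mem_iUnion.2 ⟨_, hv⟩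
  · rw [Function.extend_apply' _ _ _ huf] at hv
    cases hv
    exact ⟨Or.inr hu, huf⟩

/-- `Reduct t x e Raw drop s w`: the term `w` arises from the subterm `s` of `t` by substituting
unfolded definitions of `t` for some variables and, if `drop` holds, by eliminating `x` in favour
of `e`; this elimination need not take place at the subterms that satisfy `Raw`. -/
inductive Reduct (t : Term V) (x : V) (e : Term V) (Raw : Term V → Prop) (drop : Prop) :
    Term V → Term V → Prop
  | var {v : V} : v ≠ x ∨ Raw (.var v) → Reduct t x e Raw drop (.var v) (.var v)
  | value {w : Term V} : drop → Reduct t x e Raw drop e w → Reduct t x e Raw drop (.var x) w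
  | lam {y : V} {b w : Term V} : y ≠ x ∨ Raw (.lam y b) → Reduct t x e Raw drop b w →
      Reduct t x e Raw drop (.lam y b) (.lam y w)
  | dropLam {b w : Term V} : drop → Reduct t x e Raw drop b w →
      Reduct t x e Raw drop (.lam x b) w
  | app {p q w w' : Term V} : ¬ Exposes t x 0 p ∨ Raw (.app p q) →
      Reduct t x e Raw drop p w → Reduct t x e Raw drop q w' →
      Reduct t x e Raw drop (.app p q) (.app w w')
  | dropApp {p w : Term V} (q : Term V) : drop → Exposes t x 0 p → Reduct t x e Raw drop p w →
      Reduct t x e Raw drop (.app p q) w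
  | letrec {n : ℕ} (f : Fin n → V) {s w : Fin n → Term V} {b w' : Term V} :
      (∀ i, Reduct t x e Raw drop (s i) (w i)) → Reduct t x e Raw drop b w' →
      Reduct t x e Raw drop (.letrec n f s b) (.letrec n f w w')
  | closure {n : ℕ} {f : Fin n → V} {s w : Fin n → Term V} {b w' : Term V} (i : Fin n) :
      Term.Sub (.letrec n f s b) t → (∀ i, Reduct t x e Raw drop (s i) (w i)) →
      Reduct t x e Raw drop (s i) w' → Reduct t x e Raw drop (.var (f i)) (.letrec n f w w')

section

variable {t : Term V} {x : V} {e : Term V} {Raw : Term V → Prop} {drop : Prop}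

/-- Replacing variables by their own reducts changes the stage of unfolding but not the subterm of
`t` it comes from. The alternative `θ v = .var v` is what remains for a variable bound inside `w`.
-/
theorem Reduct.subst {s w : Term V} (h : Reduct t x e Raw drop s w) :
    ∀ θ : V → Term V, (∀ v, θ v = .var v ∨ Reduct t x e Raw drop (.var v) (θ v)) →
      Reduct t x e Raw drop s (Term.subst θ w) := by
  classical
  have hext : ∀ {n : ℕ} (f : Fin n → V) {θ : V → Term V},
      (∀ v, θ v = .var v ∨ Reduct t x e Raw drop (.var v) (θ v)) →
      ∀ v, Function.extend f (fun j => Term.var (f j)) θ v = .var v ∨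
        Reduct t x e Raw drop (.var v) (Function.extend f (fun j => Term.var (f j)) θ v) := by
    intro n f θ hθ v
    by_cases hf : ∃ i, f i = v
    · rw [Function.extend_def, dif_pos hf, hf.choose_spec]
      exact Or.inl rfl
    · rw [Function.extend_apply' _ _ _ hf]
      exact hθ v
  induction h with
  | var hv =>
    intro θ hθ
    rcases hθ _ with h | h
    · rw [Term.subst, h]
      exact .var hv
    · exact h
  | value hd _ ih => exact fun θ hθ => .value hd (ih θ hθ)
  | lam hy _ ih =>
    intro θ hθ
    refine .lam hy (ih _ fun v => ?_)
    rename_i y _ _ _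
    by_cases hvy : v = y
    · subst hvy
      rw [Function.update_self]
      exact Or.inl rfl
    · rw [Function.update_of_ne hvy]
      exact hθ v
  | dropLam hd _ ih => exact fun θ hθ => .dropLam hd (ih θ hθ)
  | app hp _ _ ihp ihq => exact fun θ hθ => .app hp (ihp θ hθ) (ihq θ hθ)
  | dropApp q hd hp _ ih => exact fun θ hθ => .dropApp q hd hp (ih θ hθ)
  | letrec f _ _ ihs ihb =>
    exact fun θ hθ => .letrec f (fun i => ihs i _ (hext f hθ)) (ihb _ (hext f hθ))
  | closure i hs _ _ ihs ihb =>
    exact fun θ hθ => .closure i hs (fun i => ihs i _ (hext _ hθ)) (ihb _ (hext _ hθ))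

theorem Reduct.unfold {n : ℕ} {f : Fin n → V} {s w : Fin n → Term V} {b r w' : Term V}
    (ht : t.binders.Nodup) (hs : Term.Sub (.letrec n f s b) t)
    (hw : ∀ i, Reduct t x e Raw drop (s i) (w i)) (h : Reduct t x e Raw drop r w') :
    Reduct t x e Raw drop r
      (Term.subst (Function.extend f (fun i => .letrec n f w (w i)) .var) w') := by
  refine h.subst _ fun v => ?_
  by_cases hf : ∃ i, f i = v
  · obtain ⟨i, rfl⟩ := hf
    rw [(hs.injective_of_nodup ht).extend_apply]
    exact Or.inr (.closure i hs hw (hw i))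
  · rw [Function.extend_apply' _ _ _ hf]
    exact Or.inl rfl

variable (t x e Raw drop) in
/-- The term `w` is a reduct of an occurrence of `s` whose scope `L` consists of variables in `A`,
and the variables in `A` that are bound by equations have been replaced. -/
structure State (L : Set (Option V)) (A : Set V) (s w : Term V) : Prop where
  scope : Term.Scope e L s t
  passed : ∀ v, some v ∈ L → v ∈ A
  reduct : Reduct t x e Raw drop s w
  closed : ∀ v ∈ A, ∀ d, t.HasEquation v d → v ∉ w.free

variable {L : Set (Option V)} {A : Set V} {w : Term V}

/-- The defined names disappear from the free variables: the substituted closures bind them again.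
-/
theorem State.letrec (ht : t.WellNamed) {n : ℕ} {f : Fin n → V} {s : Fin n → Term V} {b : Term V}
    (h : State t x e Raw drop L A (.letrec n f s b) w) :
    ∃ w', Term.UnfoldStep w w' ∧
      State t x e Raw drop (L ∪ some '' Set.range f) (A ∪ Set.range f) b w' := by
  obtain ⟨hs, hp, hr, hc⟩ := h
  cases hr with
  | letrec _ hw hb =>
    refine ⟨_, .mk _ _ _ _, ?_, ?_, hb.unfold ht.1 hs.sub hw, ?_⟩
    · have := hs.trans (.letrecBody f s (.refl b))
      rwa [Set.union_empty] at this
    · rintro v (hv | ⟨_, hv, h⟩)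
      · exact Or.inl (hp v hv)
      · cases h
        exact Or.inr hv
    · intro v hv d hd hvf
      have hvf := Term.mem_free_unfold hvf
      rcases hv with hv | hv
      · exact hc v hv d hd hvf
      · exact hvf.2 hv

/-- The occurrence of `f` lies in the scope of its equation, so `f` has been passed and is no longer
free in `w`. Hence `w` is not the bare variable but a closure, and its unfolding step leads to a
reduct of the definition. -/
theorem State.jump (ht : t.WellNamed) (hx : drop → ∀ d, ¬ t.HasEquation x d) {f : V} {d : Term V}
    (hf : t.HasEquation f d) (h : State t x e Raw drop L A (.var f) w) :
    ∃ w' L', Term.UnfoldStep w w' ∧ L' ⊆ L ∧ State t x e Raw drop L' A d w' := by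
  obtain ⟨hs, hp, hr, hc⟩ := h
  obtain ⟨hfL, L', hL', hd⟩ := hs.exists_definition ht hf
  cases hr with
  | var _ => exact absurd rfl (hc f (hp f hfL) d hf)
  | value hdrop _ => exact absurd hf (hx hdrop d)
  | closure i hsub hw hi =>
    obtain rfl := hf.unique ht.1 (hsub.hasEquation i)
    exact ⟨_, L', .mk _ _ _ _, hL', hd, fun v hv => hp v (hL' hv), hi.unfold ht.1 hsub hw,
      fun v hv d hd hvf => hc v hv d hd (Term.mem_free_unfold hvf)⟩

theorem State.lam (ht : t.WellNamed) {y : V} {b w : Term V}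
    (h : State t x e Raw drop L A (.lam y b) (.lam y w)) (hw : Reduct t x e Raw drop b w) :
    State t x e Raw drop (insert (some y) L) (insert y A) b w := by
  obtain ⟨hs, hp, _, hc⟩ := h
  refine ⟨?_, ?_, hw, ?_⟩
  · have := hs.trans (.lam y (.refl b))
    rwa [Set.union_insert, Set.union_empty] at this
  · rintro v (hv | hv)
    · cases hv
      exact Or.inl rfl
    · exact Or.inr (hp v hv)
  · intro v hv d hd hvf
    have hy : v ≠ y := by
      rintro rfl
      exact hs.sub.not_hasEquation ht.1 d hd
    exact hc v (hv.resolve_left hy) d hd ⟨hvf, hy⟩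

theorem State.appL {p q w w' : Term V}
    (h : State t x e Raw drop L A (.app p q) (.app w w')) (hw : Reduct t x e Raw drop p w) :
    State t x e Raw drop L A p w := by
  obtain ⟨hs, hp, _, hc⟩ := h
  refine ⟨?_, hp, hw, fun v hv d hd hvf => hc v hv d hd (Or.inl hvf)⟩
  have := hs.trans (.appL q (.refl p))
  rwa [Set.union_empty] at this

theorem State.appR {p q w w' : Term V}
    (h : State t x e Raw drop L A (.app p q) (.app w w')) (hw : Reduct t x e Raw drop q w') :
    State t x e Raw drop (L ∪ {o | o = none ∧ q = e}) A q w' := by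
  obtain ⟨hs, hp, _, hc⟩ := h
  refine ⟨?_, ?_, hw, fun v hv d hd hvf => hc v hv d hd (Or.inr hvf)⟩
  · have := hs.trans (.appR p (.refl q))
    rwa [Set.union_empty] at this
  · rintro v (hv | ⟨hv, _⟩)
    · exact hp v hv
    · cases hv

end

/-- This admits the copies of `e` inserted by `trans`, which are not themselves transformed. -/
theorem Reduct.self (t : Term V) (x : V) (e : Term V) {Raw : Term V → Prop} (drop : Prop)
    {s : Term V} (hs : ∀ r, Term.Sub r s → Raw r) : Reduct t x e Raw drop s s := by
  induction s with
  | var v => exact .var (Or.inr (hs _ (.refl _)))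
  | lam y b ih => exact .lam (Or.inr (hs _ (.refl _))) (ih fun r hr => hs r (.lam y hr))
  | app p q ihp ihq =>
    exact .app (Or.inr (hs _ (.refl _))) (ihp fun r hr => hs r (.appL q hr))
      (ihq fun r hr => hs r (.appR p hr))
  | letrec n f s b ihs ihb =>
    exact .letrec f (fun i => ihs i fun r hr => hs r (.letrecDef f b i hr))
      (ihb fun r hr => hs r (.letrecBody f s hr))

theorem push_resolve {ρ : V → ITerm V} {ctx : List V} {v : V} (h : ρ v = resolve ctx v) (y : V) :
    push ρ y v = resolve (y :: ctx) v := by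
  classical
  by_cases hy : v = y
  · subst hy
    rw [push_self, resolve, if_pos List.mem_cons_self, List.idxOf_cons_self]
  · rw [push_of_ne _ hy, h, resolve, resolve]
    by_cases hv : v ∈ ctx
    · rw [if_pos hv, if_pos (List.mem_cons_of_mem _ hv), ITerm.shift_bvar,
        List.idxOf_cons_ne _ (Ne.symm hy)]
    · rw [if_neg hv, if_neg (by simp [hy, hv]), ITerm.shift_fvar]

/-- The infinite unfolding of a uniquely named term does not depend on how its definitions are
distributed during the unfolding. -/
theorem Unfolds.env {t : Term V} (ht : t.WellNamed) (x : V) {T : ITerm V} (h : Unfolds t T) :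
    Env t ITerm.fvar t T := by
  obtain ⟨U, hT, hU⟩ := h
  -- With `Raw` always true and `drop` false, `Reduct` describes pure unfolding; the value `t` in
  -- place of `e` is a dummy.
  refine Env.coind (fun ρ s P => ∃ w ctx L A, State t x t (fun _ => True) False L A s w ∧
    (∀ v, ρ v = resolve ctx v) ∧ U w ctx P) ?_ ⟨t, [], ∅, ∅, ⟨.refl t, fun _ h => h.elim,
      .self _ _ _ _ fun _ _ => trivial, fun _ h => h.elim⟩, fun v => (if_neg (by simp)).symm, hT⟩
  rintro ρ s P ⟨w, ctx, L, A, hst, hρ, hP⟩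
  obtain ⟨w', hw, hroot⟩ := hU _ _ _ hP
  clear hP
  induction hw using Relation.ReflTransGen.head_induction_on generalizing s L A with
  | refl =>
    cases s with
    | var v =>
      by_cases hv : ∃ d, t.HasEquation v d
      · obtain ⟨d, hd⟩ := hv
        obtain ⟨w', L', hw, _⟩ := hst.jump ht False.elim hd
        cases hw
        exact hroot.elim
      · cases hst.reduct with
        | var _ =>
          obtain rfl : P = resolve ctx v := hroot
          rw [← hρ v]
          exact .var fun d hd => hv ⟨d, hd⟩
        | value hd _ => exact hd.elim
        | closure => exact hroot.elim
    | lam y b =>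
      cases hst.reduct with
      | lam _ hb =>
        obtain ⟨M, rfl, hM⟩ := hroot
        exact .lam y ⟨_, _, _, _, hst.lam ht hb, fun v => push_resolve (hρ v) y, hM⟩
      | dropLam hd _ => exact hd.elim
    | app p q =>
      cases hst.reduct with
      | app _ hp hq =>
        obtain ⟨P', Q, rfl, hP, hQ⟩ := hroot
        exact .app ⟨_, _, _, _, hst.appL hp, hρ, hP⟩ ⟨_, _, _, _, hst.appR hq, hρ, hQ⟩
      | dropApp _ hd _ _ => exact hd.elim
    | letrec n f s b =>
      obtain ⟨w', hw, _⟩ := hst.letrec ht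
      cases hw
      exact hroot.elim
  | head hstep _ ih =>
    cases s with
    | var v =>
      by_cases hv : ∃ d, t.HasEquation v d
      · obtain ⟨d, hd⟩ := hv
        obtain ⟨w', L', hw, _, hst⟩ := hst.jump ht False.elim hd
        obtain rfl := hw.unique hstep
        exact .jump hd (ih _ _ _ hst)
      · cases hst.reduct with
        | var _ => cases hstep
        | value hd _ => exact hd.elim
        | closure i hs _ _ => exact absurd ⟨_, hs.hasEquation i⟩ hv
    | lam y b =>
      cases hst.reduct with
      | lam _ hb => cases hstep
      | dropLam hd _ => exact hd.elim
    | app p q =>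
      cases hst.reduct with
      | app _ hp hq => cases hstep
      | dropApp _ hd _ _ => exact hd.elim
    | letrec n f s b =>
      obtain ⟨w', hw, hst⟩ := hst.letrec ht
      obtain rfl := hw.unique hstep
      exact .letrec f s (ih _ _ _ hst)

/-- Unfolding at the root is deterministic and stops at a root that is not a `letrec`, so both
derivations stop at the same term. -/
theorem Unfolds.unique {t : Term V} {T T' : ITerm V} (h : Unfolds t T) (h' : Unfolds t T') :
    T = T' := by
  obtain ⟨R, hT, hR⟩ := h
  obtain ⟨R', hT', hR'⟩ := h'
  refine ITerm.bisim (fun T T' => ∃ s ctx, R s ctx T ∧ R' s ctx T') ?_ ⟨t, [], hT, hT'⟩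
  rintro T T' ⟨s, ctx, hT, hT'⟩
  obtain ⟨w, hw, hroot⟩ := hR _ _ _ hT
  obtain ⟨w', hw', hroot'⟩ := hR' _ _ _ hT'
  have normal : ∀ {R : Term V → List V → ITerm V → Prop} {w u : Term V} {T : ITerm V},
      UnfoldRoot R w ctx T → Relation.ReflTransGen Term.UnfoldStep w u → u = w := by
    intro R w u T hroot hw
    rcases hw.cases_head with h | ⟨_, h, _⟩
    · exact h.symm
    · cases h
      exact hroot.elim
  obtain rfl : w = w' := by
    rcases Relation.ReflTransGen.total_of_right_unique
      (fun _ _ _ h h' => h.unique h') hw hw' with h | h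
    · exact (normal hroot h).symm
    · exact normal hroot' h
  cases w with
  | var v =>
    obtain rfl : T = resolve ctx v := hroot
    obtain rfl : T' = resolve ctx v := hroot'
    exact .refl _
  | lam y b =>
    obtain ⟨M, rfl, hM⟩ := hroot
    obtain ⟨M', rfl, hM'⟩ := hroot'
    exact .lam y ⟨_, _, hM, hM'⟩
  | app p q =>
    obtain ⟨P, Q, rfl, hP, hQ⟩ := hroot
    obtain ⟨P', Q', rfl, hP', hQ'⟩ := hroot'
    exact .app ⟨_, _, hP, hP'⟩ ⟨_, _, hQ, hQ'⟩
  | letrec => exact hroot.elim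

/-! ### Elimination and contraction in parallel -/

/-- The variables whose binders enclose every occurrence of `e` in `t`. -/
def core (t e : Term V) : Set V := {v | ∀ L, Term.Scope e L e t → some v ∈ L}

namespace SingleEdge

variable {t e : Term V} {x : V}

theorem not_hasEquation (h : SingleEdge t x e) (d : Term V) : ¬ t.HasEquation x d := by
  obtain ⟨b, hb⟩ := h.abstracts
  exact hb.not_hasEquation h.wellNamed.1 d

theorem mem_binders (h : SingleEdge t x e) : x ∈ t.binders := by
  obtain ⟨b, hb⟩ := h.abstracts
  exact hb.binders_sublist.subset List.mem_cons_self

theorem notMem_free (h : SingleEdge t x e) : x ∉ t.free :=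
  fun hx => h.wellNamed.2 x hx h.mem_binders

theorem mem_core_of_live (h : SingleEdge t x e) {v : V} (hv : Term.Live t v e)
    (hvt : v ∈ t.binders) : v ∈ core t e :=
  fun _ hL => (hv.mem_or_mem_free h.wellNamed hL).resolve_right fun hf => h.wellNamed.2 v hf hvt

/-- The binder `λy` occurs only once and encloses every occurrence of `e`; so does everything that
encloses it. -/
theorem mem_core_of_scope (h : SingleEdge t x e) {y v : V} {b : Term V} {L : Set (Option V)}
    (hy : y ∈ core t e) (hL : Term.Scope e L (.lam y b) t) (hv : some v ∈ L) : v ∈ core t e := by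
  intro L' hL'
  obtain ⟨L₀, r, h1, h2, h3, _⟩ := hL'.exists_binder (hy L' hL')
  obtain ⟨_, rfl⟩ := h1.unique_binder h.wellNamed.1 hL h2 rfl
  exact h3 hv

end SingleEdge

/-- The part of the invariant that concerns the reduct `w` of the eliminated subterm `s`, reached
below the abstractions in `ctx` after the binders of the variables in `A` have been passed. The
environment `ρ` gives the values that the abstracted variables have in the contracted unfolding. -/
structure Config (t : Term V) (x : V) (e : Term V) (L : Set (Option V)) (A : Set V)
    (ρ : V → ITerm V) (ctx : List V) (s w : Term V) : Prop where
  state : State t x e (fun r => Term.Sub r e) True L A s w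
  cold : none ∈ L → ∀ k, ¬ Exposes t x k s
  hot : (∃ k, Exposes t x k s) ∨ x ∈ A →
    ∃ L', Term.Scope e L' e t ∧ none ∈ L' ∧ ∀ v, some v ∈ L' → v ∈ A
  fresh : x ∈ A → x ∉ core t e ∧ x ∉ e.binders
  quiet : ∀ y ∈ A, y ∈ core t e → ∀ b, Term.Sub (.lam y b) t → ∀ k, ¬ Exposes t x k (.lam y b)
  live : Term.Live t x s → Env t ρ e (ρ x)
  inert : ∀ v, ITerm.Inert x (ρ v)
  resolves : ∀ v, v ≠ x → ρ v = resolve ctx v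

/-- The part of the invariant that concerns the contracted term `S`: it arises from the unfolding
`P` of `s` by removing the exposed abstractions over `x` in favour of `E`. -/
structure Pending (t : Term V) (x : V) (e : Term V) (ρ : V → ITerm V) (s : Term V)
    (P E S : ITerm V) : Prop where
  env : Env t ρ s P
  inert : ITerm.Inert x E
  value : (∃ k, Exposes t x k s) → Env t ρ e E
  remove : ITerm.Remove x {k | Exposes t x k s} E P S

/-- The invariant of the two computations. -/
def Matches (t : Term V) (x : V) (e : Term V) (ctx : List V) (w : Term V) (S : ITerm V) : Prop :=
  ∃ L A ρ s P E, Config t x e L A ρ ctx s w ∧ Pending t x e ρ s P E S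

/-- Equal roots, with immediate subterms that satisfy the invariant. -/
inductive Kept (t : Term V) (x : V) (e : Term V) (ctx : List V) : Term V → ITerm V → Prop
  | var (v : V) : Kept t x e ctx (.var v) (resolve ctx v)
  | lam (y : V) {w : Term V} {S : ITerm V} : Matches t x e (y :: ctx) w S →
      Kept t x e ctx (.lam y w) (ITerm.lam y S)
  | app {w w' : Term V} {S S' : ITerm V} : Matches t x e ctx w S → Matches t x e ctx w' S' →
      (∀ W, ¬ ITerm.GBetaStep x (ITerm.app S S') W) → Kept t x e ctx (.app w w') (ITerm.app S S')

/-! ### Preservation of the invariant, move by move. -/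

section

variable {t : Term V} {x : V} {e : Term V} {L : Set (Option V)} {A : Set V} {ρ : V → ITerm V}
  {ctx : List V} {s w : Term V} {P E S : ITerm V}

theorem Config.letrec (h : SingleEdge t x e) {n : ℕ} {f : Fin n → V} {s : Fin n → Term V}
    {b : Term V} (hc : Config t x e L A ρ ctx (.letrec n f s b) w) :
    ∃ w', Term.UnfoldStep w w' ∧
      Config t x e (L ∪ some '' Set.range f) (A ∪ Set.range f) ρ ctx b w' := by
  obtain ⟨w', hw, hst⟩ := hc.state.letrec h.wellNamed
  have hx : x ∈ A ∪ Set.range f → x ∈ A := by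
    rintro (hx | ⟨i, rfl⟩)
    · exact hx
    · exact absurd (hc.state.scope.sub.hasEquation i) (h.not_hasEquation _)
  refine ⟨w', hw, hst, ?_, ?_, fun hxA => hc.fresh (hx hxA), ?_, fun hl => hc.live (.letrec f s hl),
    hc.inert, hc.resolves⟩
  · rintro (hL | ⟨_, _, hL⟩) k hk
    · exact hc.cold hL k (.letrec f s hk)
    · cases hL
  · intro hh
    obtain ⟨L', h1, h2, h3⟩ := hc.hot (hh.imp (fun ⟨k, hk⟩ => ⟨k, .letrec f s hk⟩) hx)
    exact ⟨L', h1, h2, fun v hv => Or.inl (h3 v hv)⟩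
  · rintro y (hy | ⟨i, rfl⟩) hyc b' hb'
    · exact hc.quiet y hy hyc b' hb'
    · exact absurd (hc.state.scope.sub.hasEquation i) (hb'.not_hasEquation h.wellNamed.1 _)

theorem Pending.letrec {n : ℕ} {f : Fin n → V} {s : Fin n → Term V} {b : Term V}
    (hp : Pending t x e ρ (.letrec n f s b) P E S) : Pending t x e ρ b P E S := by
  have hset : {k | Exposes t x k (.letrec n f s b)} = {k | Exposes t x k b} := by
    ext k
    exact ⟨fun hk => by cases hk; assumption, fun hk => .letrec f s hk⟩
  exact ⟨hp.env.letrec_inv, hp.inert, fun ⟨k, hk⟩ => hp.value ⟨k, .letrec f s hk⟩,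
    hset ▸ hp.remove⟩

theorem Config.jump (h : SingleEdge t x e) {f : V} {d : Term V} (hf : t.HasEquation f d)
    (hc : Config t x e L A ρ ctx (.var f) w) :
    ∃ w' L', Term.UnfoldStep w w' ∧ Config t x e L' A ρ ctx d w' := by
  obtain ⟨w', L', hw, hL', hst⟩ := hc.state.jump h.wellNamed (fun _ => h.not_hasEquation) hf
  exact ⟨w', L', hw, hst, fun hL k hk => hc.cold (hL' hL) k (.var hf hk),
    fun hh => hc.hot (hh.imp_left fun ⟨k, hk⟩ => ⟨k, .var hf hk⟩), hc.fresh, hc.quiet,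
    fun hl => hc.live (.jump hf hl), hc.inert, hc.resolves⟩

theorem Pending.jump (h : SingleEdge t x e) {f : V} {d : Term V} (hf : t.HasEquation f d)
    (hp : Pending t x e ρ (.var f) P E S) : Pending t x e ρ d P E S := by
  have hset : {k | Exposes t x k (.var f)} = {k | Exposes t x k d} := by
    ext k
    exact ⟨fun hk => hk.jump_inv h.wellNamed.1 hf, fun hk => .var hf hk⟩
  exact ⟨hp.env.jump_inv h.wellNamed.1 hf, hp.inert, fun ⟨k, hk⟩ => hp.value ⟨k, .var hf hk⟩,
    hset ▸ hp.remove⟩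

theorem Pending.eq_of_forall_not (hp : Pending t x e ρ s P E S) (hs : ∀ k, ¬ Exposes t x k s) :
    S = P :=
  hp.remove.eq_of_empty (Set.eq_empty_of_forall_notMem hs)

/-- Nothing is to be removed, so `bvar 0` is only a placeholder; any inert term would do. -/
theorem Pending.of_forall_not (hP : Env t ρ s P) (hs : ∀ k, ¬ Exposes t x k s) :
    Pending t x e ρ s P (ITerm.bvar 0) P := by
  refine ⟨hP, ITerm.inert_bvar x 0, fun ⟨k, hk⟩ => absurd hk (hs k), ?_⟩
  rw [show {k | Exposes t x k s} = ∅ from Set.eq_empty_of_forall_notMem hs]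
  exact .done _ _

theorem not_exposes_var {v : V} (hv : ∀ d, ¬ t.HasEquation v d) (k : ℕ) :
    ¬ Exposes t x k (.var v) := by
  intro hk
  cases hk with
  | var hd => exact hv _ hd

/-- The variable `x` has been passed when it is reached. -/
theorem Config.mem_of_var (h : SingleEdge t x e) (hc : Config t x e L A ρ ctx (.var x) w) :
    x ∈ A :=
  hc.state.passed x ((hc.state.scope.mem_or_mem_free (v := x) rfl).resolve_right h.notMem_free)

theorem Config.not_live (h : SingleEdge t x e) (hc : Config t x e L A ρ ctx s w) (hx : x ∈ A) :
    ¬ Term.Live t x e :=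
  fun hl => (hc.fresh hx).1 (h.mem_core_of_live hl h.mem_binders)

/-- An `x` inside `e` would be bound either inside `e` or around every occurrence of `e`; `fresh`
excludes both. So a reduct of `x` is a reduct of `e`, and not a leftover from a raw copy of `e`. -/
theorem Config.not_sub_of_var (h : SingleEdge t x e) (hc : Config t x e L A ρ ctx (.var x) w) :
    ¬ Term.Sub (.var x) e := by
  intro hs
  obtain ⟨h1, h2⟩ := hc.fresh (hc.mem_of_var h)
  rcases Term.mem_free_or_mem_binders hs with hx | hx
  · exact h1 fun L hL => (hL.mem_or_mem_free hx).resolve_right h.notMem_free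
  · exact h2 hx

theorem Config.value (h : SingleEdge t x e) (hc : Config t x e L A ρ ctx (.var x) w) :
    ∃ L', Config t x e L' A ρ ctx e w := by
  have hxA := hc.mem_of_var h
  -- The walk through `t` continues at an occurrence of `e` whose enclosing binders have all been
  -- passed.
  obtain ⟨L', h1, h2, h3⟩ := hc.hot (Or.inr hxA)
  refine ⟨L', ⟨h1, h3, ?_, hc.state.closed⟩, fun _ => h.value_inert, fun _ => ⟨L', h1, h2, h3⟩,
    hc.fresh, hc.quiet, fun hl => absurd hl (hc.not_live h hxA), hc.inert, hc.resolves⟩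
  cases hc.state.reduct with
  | var hr => exact absurd (hr.resolve_left fun hne => hne rfl) (hc.not_sub_of_var h)
  | value _ hr => exact hr
  | closure i hs => exact absurd (hs.hasEquation i) (h.not_hasEquation _)

theorem Pending.value_of_var (h : SingleEdge t x e) (hc : Config t x e L A ρ ctx (.var x) w)
    (hp : Pending t x e ρ (.var x) P E S) : Pending t x e ρ e S (ITerm.bvar 0) S := by
  refine .of_forall_not ?_ h.value_inert
  rw [hp.eq_of_forall_not (not_exposes_var h.not_hasEquation),
    hp.env.var_inv h.not_hasEquation]
  exact hc.live (.var h.not_hasEquation)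

theorem lower_exposes_lam (y : V) (b : Term V) :
    ITerm.lower {k | Exposes t x k (.lam y b)} = {k | Exposes t x k b} := by
  ext k
  constructor
  · intro hk
    rcases Exposes.lam_inv hk with ⟨h, _⟩ | ⟨k', h, hk⟩
    · cases h
    · cases h
      exact hk
  · exact fun hk => .lam y hk

/-- When `λx` is reached, it is not inside the argument that it is going to receive. -/
theorem Config.fresh_of_lam (h : SingleEdge t x e) {b : Term V}
    (hc : Config t x e L A ρ ctx (.lam x b) w) : x ∉ core t e ∧ x ∉ e.binders := by
  obtain ⟨L', h1, h2, h3⟩ := hc.hot (Or.inl ⟨0, .hit b⟩)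
  refine ⟨fun hx => (hc.fresh (h3 x (hx L' h1))).1 hx, fun hx => ?_⟩
  obtain ⟨r, hr, hxr⟩ := Term.exists_binds_of_mem_binders hx
  obtain ⟨L'', hr⟩ := hr.exists_scope e
  obtain ⟨_, rfl⟩ := hc.state.scope.unique_binder h.wellNamed.1 (h1.trans hr) rfl hxr
  exact hc.cold (Or.inl h2) 0 (.hit b)

theorem Config.not_sub_of_lam (h : SingleEdge t x e) {b : Term V}
    (hc : Config t x e L A ρ ctx (.lam x b) w) : ¬ Term.Sub (.lam x b) e :=
  fun hs => (hc.fresh_of_lam h).2 (hs.binders_sublist.subset List.mem_cons_self)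

-- Neither side moves: `λx` is already absent from `w` and from `S`, and only the value of `x` is
-- recorded. Since `x` is not live in `e`, the update does not affect the value of `e` itself.
open Classical in
theorem Config.dropLam (h : SingleEdge t x e) {b : Term V}
    (hc : Config t x e L A ρ ctx (.lam x b) w) (hp : Pending t x e ρ (.lam x b) P E S) :
    Config t x e (insert (some x) L) (insert x A) (Function.update ρ x E) ctx b w ∧
    ∃ M, P = ITerm.lam x M ∧
      Pending t x e (Function.update ρ x E) b (ITerm.inst M E) E S := by
  have hfresh := hc.fresh_of_lam h
  have henv : Env t (Function.update ρ x E) e E := by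
    refine (hp.value ⟨0, .hit b⟩).congr fun v hv => ?_
    rw [Function.update_of_ne]
    rintro rfl
    exact hfresh.1 (h.mem_core_of_live hv h.mem_binders)
  constructor
  · refine ⟨⟨?_, ?_, ?_, ?_⟩, ?_, ?_, fun _ => hfresh, ?_, ?_, ?_, ?_⟩
    · have := hc.state.scope.trans (.lam x (.refl b))
      rwa [Set.union_insert, Set.union_empty] at this
    · rintro v (hv | hv)
      · cases hv
        exact Or.inl rfl
      · exact Or.inr (hc.state.passed v hv)
    · cases hc.state.reduct with
      | lam hr => exact absurd (hr.resolve_left fun hne => hne rfl) (hc.not_sub_of_lam h)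
      | dropLam _ hr => exact hr
    · rintro v (rfl | hv) d hd
      · exact absurd hd (h.not_hasEquation d)
      · exact hc.state.closed v hv d hd
    · rintro (hL | hL)
      · cases hL
      · exact absurd (.hit b) (hc.cold hL 0)
    · intro _
      obtain ⟨L', h1, h2, h3⟩ := hc.hot (Or.inl ⟨0, .hit b⟩)
      exact ⟨L', h1, h2, fun v hv => Or.inr (h3 v hv)⟩
    · rintro y (rfl | hy) hyc
      · exact absurd hyc hfresh.1
      · exact hc.quiet y hy hyc
    · intro _
      rwa [Function.update_self]
    · intro v
      by_cases hv : v = x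
      · subst hv
        rw [Function.update_self]
        exact hp.inert
      · rw [Function.update_of_ne hv]
        exact hc.inert v
    · intro v hv
      rw [Function.update_of_ne hv]
      exact hc.resolves v hv
  · obtain ⟨M, rfl, hM⟩ := hp.env.lam_inv
    refine ⟨M, rfl, hM.inst E, hp.inert, fun _ => henv, ?_⟩
    rcases hp.remove.lam_inv with ⟨_, _, hr⟩ | ⟨h0, _⟩
    · rwa [lower_exposes_lam] at hr
    · exact absurd (.hit b) h0

theorem Config.not_sub_of_app (h : SingleEdge t x e) {p q : Term V}
    (hc : Config t x e L A ρ ctx (.app p q) w) (hpx : Exposes t x 0 p) :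
    ¬ Term.Sub (.app p q) e :=
  fun hs => Term.not_sub_app hs (h.arg_eq p q hc.state.scope.sub hpx)

theorem raise_exposes_app {p q : Term V} (hpx : ¬ Exposes t x 0 p) :
    ITerm.raise {k | Exposes t x k (.app p q)} = {k | Exposes t x k p} := by
  ext k
  cases k with
  | zero => exact iff_of_false (ITerm.zero_notMem_raise _) hpx
  | succ k =>
    rw [ITerm.succ_mem_raise]
    exact ⟨fun hk => by cases hk; assumption, fun hk => .app q hk⟩

theorem insert_raise_exposes_app {p q : Term V} (hpx : Exposes t x 0 p) :
    insert 0 (ITerm.raise {k | Exposes t x k (.app p q)}) = {k | Exposes t x k p} := by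
  ext k
  cases k with
  | zero => exact iff_of_true (Set.mem_insert _ _) hpx
  | succ k =>
    rw [Set.mem_insert_iff, ITerm.succ_mem_raise]
    exact ⟨fun hk => by
      rcases hk with hk | hk
      · cases hk
      · cases hk
        assumption, fun hk => Or.inr (.app q hk)⟩

/-- The application is absent from `w`, whereas `S` still has it and contracts it in one step;
afterwards level `0` of `p` belongs to the removed levels too. -/
theorem Config.dropApp (h : SingleEdge t x e) {p q : Term V}
    (hc : Config t x e L A ρ ctx (.app p q) w) (hpx : Exposes t x 0 p)
    (hp : Pending t x e ρ (.app p q) P E S) :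
    Config t x e L A ρ ctx p w ∧
    ∃ P' Q S', ITerm.GBetaStep x S S' ∧ Pending t x e ρ p P' Q S' := by
  obtain rfl := h.arg_eq p q hc.state.scope.sub hpx
  have hscope : Term.Scope q (L ∪ ({o | o = none ∧ q = q} ∪ ∅)) q t :=
    hc.state.scope.trans (.appR p (.refl q))
  constructor
  · refine ⟨⟨?_, hc.state.passed, ?_, hc.state.closed⟩, ?_, ?_, hc.fresh, hc.quiet,
      fun hl => hc.live (.appL q hl), hc.inert, hc.resolves⟩
    · have := hc.state.scope.trans (.appL q (.refl p))
      rwa [Set.union_empty] at this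
    · cases hc.state.reduct with
      | app hr =>
        exact absurd (hr.resolve_left fun hne => hne hpx) (hc.not_sub_of_app h hpx)
      | dropApp _ _ _ hr => exact hr
    -- Here `q` is `e`: inside an argument equal to `e`, the application would be a subterm of its
    -- own argument.
    · intro hL
      exact absurd rfl (Term.not_sub_app (hc.state.scope.sub_of_none_mem hL))
    · refine fun _ => ⟨_, hscope, Or.inr (Or.inl ⟨rfl, rfl⟩), ?_⟩
      rintro v (hv | ⟨hv, _⟩ | hv)
      · exact hc.state.passed v hv
      · cases hv
      · exact hv.elim
  · obtain ⟨P', Q, rfl, hP', hQ⟩ := hp.env.app_inv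
    obtain ⟨R, rfl, hR⟩ := hp.remove.app_inv
    -- All pending removals share one argument: if there are any, `E` and `Q` are both the unfolding
    -- of `e` in `ρ`. If there are none, `E` is irrelevant and may be exchanged for `Q`.
    have hR' : ITerm.Remove x (ITerm.raise {k | Exposes t x k (.app p q)}) Q P' R := by
      by_cases hex : ∃ k, Exposes t x k (.app p q)
      · rwa [hQ.unique h.wellNamed.1 (hp.value hex)]
      · have hempty : ITerm.raise {k | Exposes t x k (.app p q)} = ∅ := by
          rw [show {k | Exposes t x k (.app p q)} = ∅ from
            Set.eq_empty_of_forall_notMem fun k hk => hex ⟨k, hk⟩, ITerm.raise_empty]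
        rw [hR.eq_of_empty hempty, hempty]
        exact .done _ _
    obtain ⟨n, hn⟩ := hpx.unfolding h.wellNamed.1 hP'
    obtain ⟨S', h1, h2⟩ := hR'.exists_contract hn (ITerm.zero_notMem_raise _)
    rw [insert_raise_exposes_app hpx] at h2
    exact ⟨P', Q, S', .mk h1, hP', hQ.inert hc.inert h.value_inert, fun _ => hQ, h2⟩

/-- Both `E` and `ρ x` move under `λy`; what has to be shown is that, wherever they are needed, `y`
is not live in `e`. -/
theorem Config.kept_lam (h : SingleEdge t x e) {y : V} {b : Term V} (hy : y ≠ x)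
    (hc : Config t x e L A ρ ctx (.lam y b) w) (hp : Pending t x e ρ (.lam y b) P E S) :
    Kept t x e ctx w S := by
  have hsub := hc.state.scope.sub
  have hyt : y ∈ t.binders := hsub.binders_sublist.subset List.mem_cons_self
  -- If `λy` exposes `λx`, some occurrence of `e` has had all its enclosing binders passed, `λy`
  -- among them. But then `quiet` already says that `λy` exposes nothing.
  have hquiet : y ∈ core t e → ∀ k, ¬ Exposes t x k (.lam y b) := by
    intro hyc k hk
    obtain ⟨L', h1, _, h3⟩ := hc.hot (Or.inl ⟨k, hk⟩)
    exact hc.quiet y (h3 y (hyc L' h1)) hyc b hsub k hk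
  have hxA : x ∈ insert y A → x ∈ A := fun hx => hx.resolve_left (Ne.symm hy)
  obtain ⟨M, rfl, hM⟩ := hp.env.lam_inv
  rcases hp.remove.lam_inv with ⟨_, rfl, _⟩ | ⟨_, S', rfl, hr⟩
  · exact absurd rfl hy
  rw [lower_exposes_lam] at hr
  have hred : ∃ w', w = .lam y w' ∧ Reduct t x e (fun r => Term.Sub r e) True b w' := by
    cases hc.state.reduct with
    | lam _ hr => exact ⟨_, rfl, hr⟩
    | dropLam => exact absurd rfl hy
  obtain ⟨w', rfl, hw'⟩ := hred
  refine .lam y ⟨_, _, push ρ y, b, M, E.shift, ⟨hc.state.lam h.wellNamed hw', ?_, ?_,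
    fun hx => hc.fresh (hxA hx), ?_, ?_, ITerm.inert_push hc.inert y, ?_⟩, hM, hp.inert.shift,
    ?_, hr⟩
  · rintro (hL | hL) k hk
    · cases hL
    · exact hc.cold hL _ (.lam y hk)
  · intro hh
    obtain ⟨L', h1, h2, h3⟩ := hc.hot (hh.imp (fun ⟨k, hk⟩ => ⟨_, .lam y hk⟩) hxA)
    exact ⟨L', h1, h2, fun v hv => Or.inr (h3 v hv)⟩
  · rintro z (rfl | hz) hzc b' hb'
    · obtain ⟨⟩ := hb'.unique_binder h.wellNamed.1 hsub (v := z) rfl rfl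
      exact hquiet hzc
    · exact hc.quiet z hz hzc b' hb'
  · intro hl
    have hl' : Term.Live t x (.lam y b) := .lam (Ne.symm hy) hl
    have hxL := (hl'.mem_or_mem_free h.wellNamed hc.state.scope).resolve_right h.notMem_free
    rw [push_of_ne _ (Ne.symm hy)]
    refine (hc.live hl').push fun hye => ?_
    -- If `y` were live in `e`, then `λy` would enclose every `e`, and so would `λx`, which encloses
    -- `λy`; this contradicts `fresh`.
    exact (hc.fresh (hc.state.passed x hxL)).1
      (h.mem_core_of_scope (h.mem_core_of_live hye hyt) hc.state.scope hxL)
  · exact fun v hv => push_resolve (hc.resolves v hv) y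
  · rintro ⟨k, hk⟩
    exact (hp.value ⟨_, .lam y hk⟩).push fun hye =>
      hquiet (h.mem_core_of_live hye hyt) _ (.lam y hk)

theorem Config.kept_app (h : SingleEdge t x e) {p q : Term V} (hpx : ¬ Exposes t x 0 p)
    (hc : Config t x e L A ρ ctx (.app p q) w) (hp : Pending t x e ρ (.app p q) P E S) :
    Kept t x e ctx w S := by
  have hsub := hc.state.scope.sub
  obtain ⟨P', Q, rfl, hP', hQ⟩ := hp.env.app_inv
  obtain ⟨R, rfl, hR⟩ := hp.remove.app_inv
  have hred : ∃ w₁ w₂, w = .app w₁ w₂ ∧ Reduct t x e (fun r => Term.Sub r e) True p w₁ ∧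
      Reduct t x e (fun r => Term.Sub r e) True q w₂ := by
    cases hc.state.reduct with
    | app _ hr hr' => exact ⟨_, _, rfl, hr, hr'⟩
    | dropApp _ _ hpx' => exact absurd hpx' hpx
  obtain ⟨w₁, w₂, rfl, hw₁, hw₂⟩ := hred
  have hex : (∃ k, Exposes t x k p) → ∃ k, Exposes t x k (.app p q) := by
    rintro ⟨_ | k, hk⟩
    · exact absurd hk hpx
    · exact ⟨k, .app q hk⟩
  have hq := h.arg_inert p q hsub
  refine .app ⟨L, A, ρ, p, P', E, ⟨hc.state.appL hw₁, ?_, fun hh => hc.hot (hh.imp_left hex),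
    hc.fresh, hc.quiet, fun hl => hc.live (.appL q hl), hc.inert, hc.resolves⟩, hP', hp.inert,
    fun hh => hp.value (hex hh), ?_⟩ ⟨_, A, ρ, q, Q, _, ⟨hc.state.appR hw₂, fun _ => hq, ?_,
    hc.fresh, hc.quiet, fun hl => hc.live (.appR p hl), hc.inert, hc.resolves⟩,
    .of_forall_not hQ hq⟩ ?_
  · intro hL k hk
    obtain ⟨k, hk⟩ := hex ⟨k, hk⟩
    exact hc.cold hL k hk
  · rwa [raise_exposes_app hpx] at hR
  · rintro (⟨k, hk⟩ | hx)
    · exact absurd hk (hq k)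
    · exact hc.hot (Or.inr hx)
  -- A remaining redex would come from an exposed level `j` of `P'` with no unremoved level below
  -- it. Level `0` is never in `raise σ`, so `j = 0`, against `hpx`.
  · intro W hW
    obtain ⟨n, hn⟩ := hW.app_inv.exposes
    obtain ⟨m, j, _, h2, h3⟩ := hR.exposes_of_exposes hp.inert hn
    cases j with
    | zero => exact hpx (h3.of_unfolding hc.inert hP')
    | succ j => rw [ITerm.remaining_raise_succ] at h2; exact absurd h2 (by omega)

theorem Config.kept_var {v : V} (hv : ∀ d, ¬ t.HasEquation v d)
    (hvx : v ≠ x) (hc : Config t x e L A ρ ctx (.var v) w)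
    (hp : Pending t x e ρ (.var v) P E S) : Kept t x e ctx w S := by
  rw [hp.eq_of_forall_not (not_exposes_var hv), hp.env.var_inv hv, hc.resolves v hvx]
  cases hc.state.reduct with
  | var _ => exact .var v
  | value => exact absurd rfl hvx
  | closure i hs => exact absurd (hs.hasEquation i) (hv _)

theorem ITerm.not_gBetaStep_lam {x y : V} {M W : ITerm V} : ¬ GBetaStep x (lam y M) W := by
  intro h
  generalize hT : lam y M = T at h
  obtain ⟨_⟩ := h
  exact lam_ne_app hT

theorem ITerm.not_gBetaStep_resolve {x : V} {ctx : List V} {v : V} {W : ITerm V} :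
    ¬ GBetaStep x (resolve ctx v) W := by
  intro h
  generalize hT : resolve ctx v = T at h
  obtain ⟨_⟩ := h
  rw [resolve] at hT
  split at hT
  · exact bvar_ne_app hT
  · exact fvar_ne_app hT

theorem Kept.normal (hk : Kept t x e ctx w S) (W : ITerm V) : ¬ ITerm.GBetaStep x S W := by
  cases hk with
  | var => exact ITerm.not_gBetaStep_resolve
  | lam => exact ITerm.not_gBetaStep_lam
  | app _ _ h => exact h W

theorem Kept.not_unfoldStep (hk : Kept t x e ctx w S) (w' : Term V) :
    ¬ Term.UnfoldStep w w' := by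
  cases hk <;> rintro ⟨⟩

/-! ### From unfolding to contraction -/

/-- Contractions lead to a common root or to an unfolding step. -/
theorem Config.exists_kept_or_step (h : SingleEdge t x e) (hc : Config t x e L A ρ ctx s w)
    (hp : Pending t x e ρ s P E S) : ∃ S', Relation.ReflTransGen (ITerm.GBetaStep x) S S' ∧
      (Kept t x e ctx w S' ∨ ∃ w', Term.UnfoldStep w w' ∧ Matches t x e ctx w' S') := by
  classical
  have jump : ∀ {f : V} {d w : Term V} {L A ρ P E S}, t.HasEquation f d →
      Config t x e L A ρ ctx (.var f) w → Pending t x e ρ (.var f) P E S →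
      ∃ S', Relation.ReflTransGen (ITerm.GBetaStep x) S S' ∧
      (Kept t x e ctx w S' ∨ ∃ w', Term.UnfoldStep w w' ∧ Matches t x e ctx w' S') := by
    intro f d w L A ρ P E S hf hc hp
    obtain ⟨w', L', hw, hc'⟩ := hc.jump h hf
    exact ⟨S, .refl, Or.inr ⟨w', hw, _, _, _, _, _, _, hc', hp.jump h hf⟩⟩
  have hr := hc.state.reduct
  -- Eliminated nodes are invisible in `w`, but each is a constructor of the finite derivation of
  -- `Reduct`.
  induction hr generalizing L A ρ P E S with
  | @var v hv =>
    by_cases hd : ∃ d, t.HasEquation v d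
    · exact jump hd.choose_spec hc hp
    · refine ⟨S, .refl, Or.inl (hc.kept_var (fun d hd' => hd ⟨d, hd'⟩) ?_ hp)⟩
      rintro rfl
      exact hc.not_sub_of_var h (hv.resolve_left fun hne => hne rfl)
  | value _ _ ih =>
    obtain ⟨L', hc'⟩ := hc.value h
    exact ih hc' (hp.value_of_var h hc)
  | lam hy _ _ =>
    refine ⟨S, .refl, Or.inl (hc.kept_lam h ?_ hp)⟩
    rintro rfl
    exact hc.not_sub_of_lam h (hy.resolve_left fun hne => hne rfl)
  | dropLam _ _ ih =>
    obtain ⟨hc', M, _, hp'⟩ := hc.dropLam h hp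
    exact ih hc' hp'
  | app hpx _ _ _ _ =>
    refine ⟨S, .refl, Or.inl (hc.kept_app h (fun hpx' => ?_) hp)⟩
    exact hc.not_sub_of_app h hpx' (hpx.resolve_left fun hne => hne hpx')
  | dropApp q _ hpx _ ih =>
    obtain ⟨hc', P', Q, S', hS, hp'⟩ := hc.dropApp h hpx hp
    obtain ⟨S'', hS', hk⟩ := ih hc' hp'
    exact ⟨S'', .head hS hS', hk⟩
  | letrec f _ _ _ _ =>
    obtain ⟨w', hw, hc'⟩ := hc.letrec h
    exact ⟨S, .refl, Or.inr ⟨w', hw, _, _, _, _, _, _, hc', hp.letrec⟩⟩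
  | closure i hs _ _ _ _ => exact jump (hs.hasEquation i) hc hp

theorem Matches.exists_kept_of_unfold (h : SingleEdge t x e) {w w' : Term V}
    (hw : Relation.ReflTransGen Term.UnfoldStep w w') (hw' : ∀ u, ¬ Term.UnfoldStep w' u)
    (hm : Matches t x e ctx w S) :
    ∃ S', Relation.ReflTransGen (ITerm.GBetaStep x) S S' ∧ Kept t x e ctx w' S' := by
  induction hw using Relation.ReflTransGen.head_induction_on generalizing S with
  | refl =>
    obtain ⟨_, _, _, _, _, _, hc, hp⟩ := hm
    obtain ⟨S', hS, hk | ⟨u, hu, _⟩⟩ := hc.exists_kept_or_step h hp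
    · exact ⟨S', hS, hk⟩
    · exact absurd hu (hw' u)
  | head hstep _ ih =>
    obtain ⟨_, _, _, _, _, _, hc, hp⟩ := hm
    obtain ⟨S', hS, hk | ⟨u, hu, hm'⟩⟩ := hc.exists_kept_or_step h hp
    · exact absurd hstep (hk.not_unfoldStep _)
    · obtain rfl := hu.unique hstep
      obtain ⟨S'', hS', hk⟩ := ih hm'
      exact ⟨S'', hS.trans hS', hk⟩

/-! ### From contraction to unfolding -/

/-- A subterm whose root is not unfolded. -/
def IsHead (t : Term V) : Term V → Prop
  | .var v => ∀ d, ¬ t.HasEquation v d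
  | .lam _ _ => True
  | .app _ _ => True
  | .letrec _ _ _ _ => False

/-- Since the unfolding `P` has a root, finitely many `letrec`s and equations precede it, and
crossing each of them is one unfolding step of `w`. -/
theorem Config.exists_head (h : SingleEdge t x e) (hc : Config t x e L A ρ ctx s w)
    (hp : Pending t x e ρ s P E S) : ∃ L' A' s' w', Relation.ReflTransGen Term.UnfoldStep w w' ∧
      IsHead t s' ∧ Config t x e L' A' ρ ctx s' w' ∧ Pending t x e ρ s' P E S ∧
      (Term.Live t x s' → Term.Live t x s) ∧
      {k | Exposes t x k s} = {k | Exposes t x k s'} := by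
  have hP := hp.env.head
  induction hP generalizing L A w with
  | @var v hv => exact ⟨L, A, .var v, w, .refl, hv, hc, hp, fun hl => hl, rfl⟩
  | @lam y b => exact ⟨L, A, .lam y b, w, .refl, trivial, hc, hp, fun hl => hl, rfl⟩
  | @app p q => exact ⟨L, A, .app p q, w, .refl, trivial, hc, hp, fun hl => hl, rfl⟩
  | letrec f s _ ih =>
    obtain ⟨w', hw, hc'⟩ := hc.letrec h
    obtain ⟨L', A', s', w'', hw', h1, h2, h3, h5, h6⟩ := ih hc' hp.letrec
    refine ⟨L', A', s', w'', .head hw hw', h1, h2, h3, fun hl => .letrec f s (h5 hl), ?_⟩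
    rw [← h6]
    ext k
    exact ⟨fun hk => by cases hk; assumption, fun hk => .letrec f s hk⟩
  | jump hf _ ih =>
    obtain ⟨w', L', hw, hc'⟩ := hc.jump h hf
    obtain ⟨L', A', s', w'', hw', h1, h2, h3, h5, h6⟩ := ih hc' (hp.jump h hf)
    refine ⟨L', A', s', w'', .head hw hw', h1, h2, h3, fun hl => .jump hf (h5 hl), ?_⟩
    rw [← h6]
    ext k
    exact ⟨fun hk => hk.jump_inv h.wellNamed.1 hf, fun hk => .var hf hk⟩

/-- Unfolding leads to a common root or to a contraction. -/
def Progress (t : Term V) (x : V) (e : Term V) (ctx : List V) (w : Term V) (S : ITerm V) : Prop :=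
  ∃ w', Relation.ReflTransGen Term.UnfoldStep w w' ∧
    (Kept t x e ctx w' S ∨ ∃ S', ITerm.GBetaStep x S S' ∧ Matches t x e ctx w' S')

theorem Progress.of_unfold {w w' : Term V} (hw : Relation.ReflTransGen Term.UnfoldStep w w')
    (h : Progress t x e ctx w' S) : Progress t x e ctx w S := by
  obtain ⟨u, hu, h⟩ := h
  exact ⟨u, hw.trans hu, h⟩

theorem Config.progress_app (h : SingleEdge t x e) {p q : Term V}
    (hc : Config t x e L A ρ ctx (.app p q) w) (hp : Pending t x e ρ (.app p q) P E S) :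
    Progress t x e ctx w S := by
  by_cases hpx : Exposes t x 0 p
  · obtain ⟨hc', P', Q, S', hS, hp'⟩ := hc.dropApp h hpx hp
    exact ⟨w, .refl, Or.inr ⟨S', hS, _, _, _, _, _, _, hc', hp'⟩⟩
  · exact ⟨w, .refl, Or.inl (hc.kept_app h hpx hp)⟩

/-- Meant for `e` standing in place of `x`: its head is neither `x` nor `λx`, so there is no loop
from `x` through `e` back to `x`. -/
theorem Config.progress_of_not_live (h : SingleEdge t x e) (hc : Config t x e L A ρ ctx s w)
    (hp : Pending t x e ρ s P E S) (hs : ∀ k, ¬ Exposes t x k s) (hl : ¬ Term.Live t x s) :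
    Progress t x e ctx w S := by
  obtain ⟨L', A', s', w', hw, hh, hc, hp, h5, h6⟩ := hc.exists_head h hp
  refine .of_unfold hw ?_
  cases s' with
  | var v =>
    refine ⟨w', .refl, Or.inl (hc.kept_var hh ?_ hp)⟩
    rintro rfl
    exact hl (h5 (.var hh))
  | lam y b =>
    refine ⟨w', .refl, Or.inl (hc.kept_lam h ?_ hp)⟩
    rintro rfl
    exact hs 0 (h6.symm.subset (Exposes.hit b))
  | app p q => exact hc.progress_app h hp
  | letrec => exact hh.elim

theorem Config.progress_var (h : SingleEdge t x e) {v : V} (hv : ∀ d, ¬ t.HasEquation v d)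
    (hc : Config t x e L A ρ ctx (.var v) w) (hp : Pending t x e ρ (.var v) P E S) :
    Progress t x e ctx w S := by
  by_cases hvx : v = x
  · subst hvx
    obtain ⟨L', hc'⟩ := hc.value h
    exact hc'.progress_of_not_live h (hp.value_of_var h hc) h.value_inert
      (hc.not_live h (hc.mem_of_var h))
  · exact ⟨w, .refl, Or.inl (hc.kept_var hv hvx hp)⟩

theorem Config.progress (h : SingleEdge t x e) (hc : Config t x e L A ρ ctx s w)
    (hp : Pending t x e ρ s P E S) : Progress t x e ctx w S := by
  classical
  have key : ∀ {L A ρ s w P E S}, Config t x e L A ρ ctx s w → Pending t x e ρ s P E S →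
      (∀ {L' A' w' b}, Config t x e L' A' ρ ctx (.lam x b) w' →
        Pending t x e ρ (.lam x b) P E S →
        {k | Exposes t x k s} = {k | Exposes t x k (.lam x b)} → Progress t x e ctx w' S) →
      Progress t x e ctx w S := by
    intro L A ρ s w P E S hc hp hlam
    obtain ⟨L', A', s', w', hw, hh, hc, hp, _, h6⟩ := hc.exists_head h hp
    refine .of_unfold hw ?_
    cases s' with
    | var v => exact hc.progress_var h hh hp
    | lam y b =>
      by_cases hy : y = x
      · subst hy
        exact hlam hc hp h6
      · exact ⟨w', .refl, Or.inl (hc.kept_lam h hy hp)⟩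
    | app p q => exact hc.progress_app h hp
    | letrec => exact hh.elim
  have hr := hp.remove
  generalize hσ : {k | Exposes t x k s} = σ at hr
  -- Crossing a `λx` changes neither `w` nor `S`, but it consumes one `hit` of the finite derivation
  -- of `Remove`; the other constructors are impossible at a head `λx`.
  induction hr generalizing L A ρ s w with
  | done =>
    refine key hc hp fun _ _ h6 => ?_
    have h0 : 0 ∈ (∅ : Set ℕ) := by
      rw [← hσ, h6]
      exact .hit _
    exact h0.elim
  | hit _ _ ih =>
    refine key hc hp fun hc hp h6 => ?_
    obtain ⟨hc', M, hM, hp'⟩ := hc.dropLam h hp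
    obtain ⟨_, rfl⟩ := ITerm.lam_injective hM
    exact ih hc' hp' (by rw [← hσ, h6, lower_exposes_lam])
  | skip y h0 _ _ =>
    refine key hc hp fun _ _ h6 => absurd ?_ h0
    rw [← hσ, h6]
    exact .hit _
  | app Q _ _ =>
    refine key hc hp fun _ hp _ => ?_
    obtain ⟨M, hM, _⟩ := hp.env.lam_inv
    exact absurd hM.symm ITerm.lam_ne_app

theorem Matches.exists_kept_of_contract (h : SingleEdge t x e) {U : ITerm V}
    (hS : Relation.ReflTransGen (ITerm.GBetaStep x) S U) (hU : ∀ W, ¬ ITerm.GBetaStep x U W)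
    (hm : Matches t x e ctx w S) :
    ∃ w', Relation.ReflTransGen Term.UnfoldStep w w' ∧ Kept t x e ctx w' U := by
  induction hS using Relation.ReflTransGen.head_induction_on generalizing w with
  | refl =>
    obtain ⟨_, _, _, _, _, _, hc, hp⟩ := hm
    obtain ⟨w', hw, hk | ⟨W, hW, _⟩⟩ := hc.progress h hp
    · exact ⟨w', hw, hk⟩
    · exact absurd hW (hU W)
  | head hstep _ ih =>
    obtain ⟨_, _, _, _, _, _, hc, hp⟩ := hm
    obtain ⟨w', hw, hk | ⟨W, hW, hm'⟩⟩ := hc.progress h hp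
    · exact absurd hstep (hk.normal _)
    · obtain rfl := hW.unique hstep
      obtain ⟨w'', hw', hk⟩ := ih hm'
      exact ⟨w'', hw.trans hw', hk⟩

end

/-! ### The diagram -/

section

variable {t e : Term V} {x : V} {T T' : ITerm V}

theorem Reduct.eliminate (t : Term V) (x : V) (e s : Term V) :
    Reduct t x e (fun r => Term.Sub r e) True s (eliminate t x e s) := by
  have he : Reduct t x e (fun r => Term.Sub r e) True e e := .self t x e True fun _ hr => hr
  induction s with
  | var v =>
    rw [LetrecCalc.eliminate]
    split
    · next hv => subst hv; exact .value trivial he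
    · next hv => exact .var (Or.inl hv)
  | lam y b ih =>
    rw [LetrecCalc.eliminate]
    split
    · next hy => subst hy; exact .dropLam trivial ih
    · next hy => exact .lam (Or.inl hy) ih
  | app p q ihp ihq =>
    rw [LetrecCalc.eliminate]
    split
    · next hp => exact .dropApp q trivial hp ihp
    · next hp => exact .app (Or.inl hp) ihp ihq
  | letrec n f s b ihs ihb => exact .letrec f ihs ihb

/-- At the start no binder has been passed and nothing is exposed, so the conditions on `x` hold
vacuously and nothing has been removed from `T`. -/
theorem SingleEdge.matches_trans (h : SingleEdge t x e) (hT : Unfolds t T) :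
    Matches t x e [] (trans t x e) T := by
  refine ⟨∅, ∅, ITerm.fvar, t, T, _, ⟨⟨.refl t, fun _ hv => hv.elim, .eliminate t x e t,
    fun _ hv => hv.elim⟩, fun hL => hL.elim, ?_, fun hx => hx.elim, fun _ hy => hy.elim, ?_,
    ITerm.inert_fvar x, fun v _ => (if_neg (by simp)).symm⟩,
    .of_forall_not (hT.env h.wellNamed x) h.inert⟩
  · rintro (⟨k, hk⟩ | hx)
    · exact absurd hk (h.inert k)
    · exact hx.elim
  · intro hl
    rcases hl.mem_or_mem_free h.wellNamed (.refl (e := e) t) with hx | hx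
    · exact hx.elim
    · exact absurd hx h.notMem_free

theorem SingleEdge.contractAll (h : SingleEdge t x e) (hT : Unfolds t T)
    (hT' : Unfolds (trans t x e) T') : ITerm.ContractAll x T T' := by
  obtain ⟨R, hR, hstep⟩ := hT'
  refine ⟨fun S S' => ∃ ctx w, Matches t x e ctx w S ∧ R w ctx S',
    ⟨[], _, h.matches_trans hT, hR⟩, ?_⟩
  rintro S S' ⟨ctx, w, hm, hR⟩
  obtain ⟨w', hw, hroot⟩ := hstep _ _ _ hR
  have hw' : ∀ u, ¬ Term.UnfoldStep w' u := by
    rintro u ⟨⟩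
    exact hroot.elim
  obtain ⟨U, hU, hk⟩ := hm.exists_kept_of_unfold h hw hw'
  refine ⟨U, hU, hk.normal, ?_⟩
  cases hk with
  | var v =>
    obtain rfl : S' = resolve ctx v := hroot
    rw [resolve]
    split
    · exact ⟨_, _, _, ITerm.dest_bvar _, ITerm.dest_bvar _, fun c => Empty.elim c⟩
    · exact ⟨_, _, _, ITerm.dest_fvar _, ITerm.dest_fvar _, fun c => Empty.elim c⟩
  | lam y hm =>
    obtain ⟨M, rfl, hM⟩ := hroot
    exact ⟨_, _, _, ITerm.dest_lam _ _, ITerm.dest_lam _ _, fun _ => ⟨_, _, hm, hM⟩⟩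
  | app hm₁ hm₂ _ =>
    obtain ⟨P, Q, rfl, hP, hQ⟩ := hroot
    refine ⟨_, _, _, ITerm.dest_app _ _, ITerm.dest_app _ _, fun c => ?_⟩
    cases c
    · exact ⟨_, _, hm₁, hP⟩
    · exact ⟨_, _, hm₂, hQ⟩

/-- Coinduction on `Matches` composed with the given contraction relation: the root reached by
contraction is normal, hence also reached by unfolding. -/
theorem SingleEdge.unfolds (h : SingleEdge t x e) (hT : Unfolds t T)
    (hT' : ITerm.ContractAll x T T') : Unfolds (trans t x e) T' := by
  obtain ⟨R, hR, hstep⟩ := hT'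
  refine ⟨fun w ctx S' => ∃ S, Matches t x e ctx w S ∧ R S S', ⟨T, h.matches_trans hT, hR⟩, ?_⟩
  rintro w ctx S' ⟨S, hm, hR⟩
  obtain ⟨U, hU, hnormal, a, ch, ch', hdest, hdest', hch⟩ := hstep _ _ hR
  obtain ⟨w', hw, hk⟩ := hm.exists_kept_of_contract h hU hnormal
  refine ⟨w', hw, ?_⟩
  cases hk with
  | var v =>
    change S' = resolve ctx v
    rw [resolve] at hdest ⊢
    split at hdest
    · next hv =>
      rw [if_pos hv]
      cases hdest
      exact ITerm.eq_of_dest_bvar hdest'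
    · next hv =>
      rw [if_neg hv]
      cases hdest
      exact ITerm.eq_of_dest_fvar hdest'
  | lam y hm =>
    cases hdest
    exact ⟨_, ITerm.eq_of_dest_lam hdest', _, hm, hch ()⟩
  | app hm₁ hm₂ _ =>
    cases hdest
    exact ⟨_, _, ITerm.eq_of_dest_app hdest', ⟨_, hm₁, hch false⟩, ⟨_, hm₂, hch true⟩⟩

end

end LetrecCalc

open LetrecCalc in
theorem mainTheorem4 {V : Type*} (t e : Term V) (x : V)
    (hnames : t.WellNamed) (hx : t.Abstracts x)
    (Γ : V → Option (AType V)) (G : Edges V) (hG : IsBindingGraph Γ t G)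
    (hedge : ∀ d, (x, d) ∈ G ↔ d = some e)
    (T : ITerm V) (hT : Unfolds t T) :
    ((∃ T', ITerm.ContractAll x T T') ↔ ∃ T', Unfolds (trans t x e) T') ∧
    ∀ T₁ T₂, ITerm.ContractAll x T T₁ → Unfolds (trans t x e) T₂ → T₁ = T₂ := by
  have h := SingleEdge.of_bindingGraph hnames hx hG hedge
  refine ⟨⟨fun ⟨T', hT'⟩ => ⟨T', h.unfolds hT hT'⟩, fun ⟨T', hT'⟩ => ⟨T', h.contractAll hT hT'⟩⟩,
    fun T₁ T₂ h₁ h₂ => (h.unfolds hT h₁).unique h₂⟩
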